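/- Let $d\in\{2,3\}$, let $X\subset\mathbb R^d$ be a bounded domain with smooth boundary and outward unit normal $\nu$, let $k>0$, $g\in L^2(\partial X;\mathbb C)$ and $0<q_{\min}<q_{\max}$. Put $$L^\infty_+(X)=\{p\in L^\infty(X;\mathbb R): q_{\min}<p<q_{\max}\ \text{a.e. in }X\}.$$ For $q\in L^\infty(X;\mathbb R)$ with $\operatorname{ess\,inf} q>0$ let $u[q]\in H^1(X;\mathbb C)$ be the weak solution of $$(\Delta+k^2+ikq)u=0\ \text{ in }X,\qquad \nu\cdot\nabla u-iku=g\ \text{ on }\partial X .$$ Here, for $f\in L^2(X)$ and $h\in L^2(\partial X)$, a weak solution of $(\Delta+k^2+ikq)u=f$ in $X$, $\nu\cdot\nabla u-iku=h$ on $\partial X$ is a function $u\in H^1(X)$ with $$-\int_X\nabla u\cdot\nabla\overline w\,dx+k^2\int_X u\overline w\,dx+ik\int_X q\,u\overline w\,dx+ik\int_{\partial X}u\overline w\,ds+\int_{\partial X}h\,\overline w\,ds=\int_X f\,\overline w\,dx\qquad\text{for all }w\in H^1(X),$$ the boundary values being traces. Let $F[q]=q\,|u[q]|^2$. Then for every $q\in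 L^\infty_+(X)$: 1. $u[q]$ exists and is unique, and $F[q]\in L^2(X)$. 2. The map $u:q\mapsto u[q]$ from $L^\infty(X;\mathbb R)$ to $H^1(X)$ (defined in a neighbourhood of $q$, since $\operatorname{ess\,inf}q>0$) is (real-)Fréchet differentiable at $q$, and for every $\rho\in L^\infty(X;\mathbb R)$ its derivative is $\mathcal Du[q](\rho)=v(\rho)$, where $v(\rho)\in H^1(X)$ is the unique weak solution of $$(\Delta+k^2+ikq)v=-ik\rho\,u[q]\ \text{ in }X,\qquad \nu\cdot\nabla v-ikv=0\ \text{ on }\partial X .$$ 3. Consequently, the data map $F$ with values in $L^2(X;\mathbb R)$ is Fréchet differentiable at $q$, and for every $\rho\in L^\infty(X;\mathbb R)$ $$\mathcal DF[q]\rho=\rho\,|u[q]|^2+2q\,\Re\big(u[q]\,\overline{v(\rho)}\big).$$ -/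

import Mathlib

open MeasureTheory Filter Topology
open scoped ContDiff ComplexConjugate

noncomputable section

namespace RobinHelmholtz

variable {d : ℕ}

/-- A smooth bounded domain of `ℝ^d`: a nonempty connected bounded open set which near each of its
boundary points is the negativity set of a smooth function with nonvanishing differential. -/
structure IsSmoothBoundedDomain (X : Set (EuclideanSpace ℝ (Fin d))) : Prop where
  isOpen : IsOpen X
  isConnected : IsConnected X
  isBounded : Bornology.IsBounded X
  smooth_boundary : ∀ x₀ ∈ frontier X, ∃ U ∈ 𝓝 x₀, ∃ r : EuclideanSpace ℝ (Fin d) → ℝ,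
    ContDiff ℝ ∞ r ∧ r x₀ = 0 ∧ fderiv ℝ r x₀ ≠ 0 ∧ X ∩ U = {x | r x < 0} ∩ U

/-- Lebesgue measure on `X`. -/
abbrev vol (X : Set (EuclideanSpace ℝ (Fin d))) : Measure (EuclideanSpace ℝ (Fin d)) :=
  volume.restrict X

/-- Surface measure on the boundary of `X`: the `(d-1)`-dimensional Hausdorff measure, in the
normalization in which it agrees with Lebesgue measure on `(d-1)`-dimensional subspaces. -/
abbrev surf (X : Set (EuclideanSpace ℝ (Fin d))) : Measure (EuclideanSpace ℝ (Fin d)) :=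
  (Measure.euclideanHausdorffMeasure (d - 1)).restrict (frontier X)

/-- The gradient of a differentiable complex-valued function. -/
def grad (φ : EuclideanSpace ℝ (Fin d) → ℂ) (x : EuclideanSpace ℝ (Fin d)) :
    EuclideanSpace ℂ (Fin d) :=
  WithLp.toLp 2 fun i => fderiv ℝ φ x (EuclideanSpace.single i 1)

/-- `G` is the weak gradient of `u` on `X`: `∫ u ∂ᵢφ = - ∫ Gᵢ φ` for all `φ ∈ C^∞_c(X)`. -/
def IsWeakGradient (X : Set (EuclideanSpace ℝ (Fin d))) (u : EuclideanSpace ℝ (Fin d) → ℂ)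
    (G : EuclideanSpace ℝ (Fin d) → EuclideanSpace ℂ (Fin d)) : Prop :=
  ∀ φ : EuclideanSpace ℝ (Fin d) → ℂ, ContDiff ℝ ∞ φ → HasCompactSupport φ → tsupport φ ⊆ X →
    ∀ i, ∫ x in X, u x * grad φ x i = - ∫ x in X, G x i * φ x

theorem memLp_test {X : Set (EuclideanSpace ℝ (Fin d))} {φ : EuclideanSpace ℝ (Fin d) → ℂ}
    (h : ContDiff ℝ ∞ φ) (hc : HasCompactSupport φ) : MemLp φ 2 (vol X) :=
  (h.continuous.memLp_of_hasCompactSupport hc).restrict X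

theorem memLp_grad {X : Set (EuclideanSpace ℝ (Fin d))} {φ : EuclideanSpace ℝ (Fin d) → ℂ}
    (h : ContDiff ℝ ∞ φ) (hc : HasCompactSupport φ) (i : Fin d) :
    MemLp (fun x => grad φ x i) 2 (vol X) := by
  refine (Continuous.memLp_of_hasCompactSupport ?_ ?_).restrict X
  · exact (h.continuous_fderiv (by simp)).clm_apply continuous_const
  · exact (hc.fderiv (𝕜 := ℝ)).mono' (fun x hx => subset_tsupport _ (by
      intro h0
      apply hx
      simp [grad, h0]))

theorem memLp_coord {X : Set (EuclideanSpace ℝ (Fin d))}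
    (G : Lp (EuclideanSpace ℂ (Fin d)) 2 (vol X)) (i : Fin d) :
    MemLp (fun x => G x i) 2 (vol X) :=
  (Lp.memLp G).of_le
    ((EuclideanSpace.proj (𝕜 := ℂ) i).continuous.comp_aestronglyMeasurable (Lp.aestronglyMeasurable G))
    (.of_forall fun x => PiLp.norm_apply_le (G x) i)

/-- The Sobolev space `H¹(X)`: the pairs `(u, ∇u)` with `u ∈ L²(X)` whose weak gradient `∇u` is in
`L²(X)`, with the norm `(‖u‖² + ‖∇u‖²)^{1/2}`. -/
def H1 (X : Set (EuclideanSpace ℝ (Fin d))) :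
    Submodule ℂ (WithLp 2 (Lp ℂ 2 (vol X) × Lp (EuclideanSpace ℂ (Fin d)) 2 (vol X))) where
  carrier := {p | IsWeakGradient X p.fst p.snd}
  zero_mem' := by
    intro φ h hc hs i
    have h1 : ∫ x in X, (0 : Lp ℂ 2 (vol X)) x * grad φ x i = 0 := by
      apply integral_eq_zero_of_ae
      filter_upwards [Lp.coeFn_zero ℂ 2 (vol X)] with x hx
      rw [hx]
      simp
    have h2 : ∫ x in X, (0 : Lp (EuclideanSpace ℂ (Fin d)) 2 (vol X)) x i * φ x = 0 := by
      apply integral_eq_zero_of_ae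
      filter_upwards [Lp.coeFn_zero (EuclideanSpace ℂ (Fin d)) 2 (vol X)] with x hx
      rw [hx]
      simp
    rw [WithLp.zero_fst, WithLp.zero_snd, h1, h2, neg_zero]
  add_mem' := by
    intro a b ha hb φ h hc hs i
    have h1 : ∫ x in X, (a.fst + b.fst : Lp ℂ 2 (vol X)) x * grad φ x i
        = (∫ x in X, a.fst x * grad φ x i) + ∫ x in X, b.fst x * grad φ x i := by
      refine Eq.trans ?_ (integral_add ((Lp.memLp a.fst).integrable_mul (memLp_grad h hc i))
        ((Lp.memLp b.fst).integrable_mul (memLp_grad h hc i)))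
      apply integral_congr_ae
      filter_upwards [Lp.coeFn_add a.fst b.fst] with x hx
      rw [hx, Pi.add_apply, add_mul]
    have h2 : ∫ x in X, (a.snd + b.snd : Lp (EuclideanSpace ℂ (Fin d)) 2 (vol X)) x i * φ x
        = (∫ x in X, a.snd x i * φ x) + ∫ x in X, b.snd x i * φ x := by
      refine Eq.trans ?_ (integral_add ((memLp_coord a.snd i).integrable_mul (memLp_test h hc))
        ((memLp_coord b.snd i).integrable_mul (memLp_test h hc)))
      apply integral_congr_ae
      filter_upwards [Lp.coeFn_add a.snd b.snd] with x hx
      rw [hx, Pi.add_apply, PiLp.add_apply, add_mul]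
    rw [WithLp.add_fst, WithLp.add_snd, h1, h2, ha φ h hc hs i, hb φ h hc hs i, neg_add]
  smul_mem' := by
    intro c a ha φ h hc hs i
    have h1 : ∫ x in X, (c • a.fst : Lp ℂ 2 (vol X)) x * grad φ x i
        = c * ∫ x in X, a.fst x * grad φ x i := by
      rw [← integral_const_mul]
      apply integral_congr_ae
      filter_upwards [Lp.coeFn_smul c a.fst] with x hx
      simp [hx, mul_assoc]
    have h2 : ∫ x in X, (c • a.snd : Lp (EuclideanSpace ℂ (Fin d)) 2 (vol X)) x i * φ x
        = c * ∫ x in X, a.snd x i * φ x := by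
      rw [← integral_const_mul]
      apply integral_congr_ae
      filter_upwards [Lp.coeFn_smul c a.snd] with x hx
      simp [hx, mul_assoc]
    rw [WithLp.smul_fst, WithLp.smul_snd, h1, h2, ha φ h hc hs i, mul_neg]

/-- The underlying `L²` function of an element of `H¹(X)`. -/
def toL2 {X : Set (EuclideanSpace ℝ (Fin d))} (u : H1 X) : Lp ℂ 2 (vol X) :=
  u.1.fst

/-- The weak gradient of an element of `H¹(X)`. -/
def weakGrad {X : Set (EuclideanSpace ℝ (Fin d))} (u : H1 X) :
    Lp (EuclideanSpace ℂ (Fin d)) 2 (vol X) :=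
  u.1.snd

/-- `t ∈ L²(∂X)` is the boundary trace of `u ∈ H¹(X)`: there are functions `φₙ`, smooth up to the
boundary, with `φₙ → u` in `H¹(X)` and `φₙ|∂X → t` in `L²(∂X)`. -/
def IsTrace {X : Set (EuclideanSpace ℝ (Fin d))} (u : H1 X) (t : Lp ℂ 2 (surf X)) : Prop :=
  ∃ φ : ℕ → EuclideanSpace ℝ (Fin d) → ℂ,
    (∀ n, ContDiff ℝ ∞ (φ n)) ∧
    Tendsto (fun n => eLpNorm (fun x => φ n x - toL2 u x) 2 (vol X)) atTop (𝓝 0) ∧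
    Tendsto (fun n => eLpNorm (fun x => grad (φ n) x - weakGrad u x) 2 (vol X)) atTop (𝓝 0) ∧
    Tendsto (fun n => eLpNorm (fun x => φ n x - t x) 2 (surf X)) atTop (𝓝 0)

/-- `u ∈ H¹(X)` is a (weak, i.e. variational) solution of `(Δ + k² + ikq) u = f` in `X`,
`ν·∇u - ik u = g` on `∂X`. -/
def IsSolution (X : Set (EuclideanSpace ℝ (Fin d))) (k : ℝ) (q : Lp ℝ ⊤ (vol X))
    (f : EuclideanSpace ℝ (Fin d) → ℂ) (g : Lp ℂ 2 (surf X)) (u : H1 X) : Prop :=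
  ∃ t : Lp ℂ 2 (surf X), IsTrace u t ∧
    ∀ (w : H1 X) (s : Lp ℂ 2 (surf X)), IsTrace w s →
      - (∫ x in X, ∑ i, weakGrad u x i * conj (weakGrad w x i))
        + (k : ℂ) ^ 2 * (∫ x in X, toL2 u x * conj (toL2 w x))
        + Complex.I * k * (∫ x in X, (q x : ℂ) * toL2 u x * conj (toL2 w x))
        + Complex.I * k * (∫ x, t x * conj (s x) ∂(surf X))
        + (∫ x, g x * conj (s x) ∂(surf X))
      = ∫ x in X, f x * conj (toL2 w x)

/-- The set `L^∞_+(X)` of the `p ∈ L^∞(X)` with `qmin < p < qmax` almost everywhere in `X`. -/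
def LInftyPlus (X : Set (EuclideanSpace ℝ (Fin d))) (qmin qmax : ℝ) : Set (Lp ℝ ⊤ (vol X)) :=
  {p | ∀ᵐ x ∂(vol X), qmin < p x ∧ p x < qmax}

open Classical in
/-- The solution map `q ↦ u[q]`, with `u[q]` the solution of `(Δ + k² + ikq) u = 0` in `X`,
`ν·∇u - ik u = g` on `∂X` (and `0` for those `q` for which there is none). -/
def solutionMap (X : Set (EuclideanSpace ℝ (Fin d))) (k : ℝ) (g : Lp ℂ 2 (surf X))
    (q : Lp ℝ ⊤ (vol X)) : H1 X :=
  if h : ∃ u : H1 X, IsSolution X k q 0 g u then h.choose else 0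

/-- The function `q |u[q]|²`. -/
def heatEnergy (X : Set (EuclideanSpace ℝ (Fin d))) (k : ℝ) (g : Lp ℂ 2 (surf X))
    (q : Lp ℝ ⊤ (vol X)) (x : EuclideanSpace ℝ (Fin d)) : ℝ :=
  q x * ‖toL2 (solutionMap X k g q) x‖ ^ 2

open Classical in
/-- The data map `q ↦ F[q] = q |u[q]|²` with values in `L²(X)`
(and `0` for those `q` for which this function is not in `L²(X)`). -/
def dataMap (X : Set (EuclideanSpace ℝ (Fin d))) (k : ℝ) (g : Lp ℂ 2 (surf X))
    (q : Lp ℝ ⊤ (vol X)) : Lp ℝ 2 (vol X) :=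
  if h : MemLp (heatEnergy X k g q) 2 (vol X) then h.toLp else 0

end RobinHelmholtz

end

open RobinHelmholtz

open MeasureTheory Filter Topology
open scoped ContDiff ComplexConjugate ENNReal NNReal InnerProductSpace InnerProduct

noncomputable section

namespace RobinHelmholtz

/-! The absorption term makes the problem coercive, so no Fredholm alternative or unique
continuation is needed. If `a(z)` is the sesquilinear form at `(z, z)`, then `Re a = -‖∇u‖² +
k²‖u‖²` and `Im a = k∫q|u|² + k‖t‖²`, with `t` the trace. For large `l`, depending only on `k` and a
lower bound of `q`, the combination `-Re a + l Im a` dominates `‖u‖² + ‖∇u‖² + ‖t‖²`, so Lax–Milgram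
applies (`isUnit_dampedOp`).

The Hilbert space is the graph of the trace relation, that is, the pairs `(u, t)` with `IsTrace u
t`. It is closed in `H¹(X) × L²(∂X)`, hence complete, and its norm contains `‖t‖`. Neither existence
nor uniqueness of traces on all of `H¹(X)` is used. On this space the weak formulation is an
operator equation `A(q) z = J†F - S†g`, where `J` and `S` send a pair to its function and its trace
(`TraceModel.isSolution_iff`).

Since `q ↦ A(q)` is affine and Lipschitz, the derivative of operator inversion gives the derivative
`-A(q)⁻¹ (ik J†ρJ) z` of the solution `z`. This is the solution with source `-ikρu`.

The data `q|u|²` is trilinear in `(q, u, ū)` and bounded `L^∞ × L⁴ × L⁴ → L²` by Hölder, so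
differentiability of `F` follows by the product rule once `H¹(X)` functions with a trace embed
continuously into `L⁴(X)`. For `d ≤ 3` this comes from a Gagliardo–Nirenberg argument on `X` itself,
without an extension operator: near each point, `X` is stable under backward translation along some
basis, so a cut-off function is controlled by integrating its derivative along half-lines that stay
in `X` as long as they meet the support. -/

/-! ### Local geometry of the domain and the Sobolev inequality for `W^{1,1}` -/

/-- Near a point of the closure, a smooth domain is stable under backward translation along the
vectors of a suitable basis. -/
theorem IsSmoothBoundedDomain.exists_ball_basis {d : ℕ} {X : Set (EuclideanSpace ℝ (Fin d))}
    (hX : IsSmoothBoundedDomain X) {x₀ : EuclideanSpace ℝ (Fin d)} (hx₀ : x₀ ∈ closure X) :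
    ∃ ε > 0, ∃ v : Module.Basis (Fin d) ℝ (EuclideanSpace ℝ (Fin d)),
      ∀ x ∈ X ∩ Metric.ball x₀ ε, ∀ i, ∀ t ≤ (0 : ℝ),
        x + t • v i ∈ Metric.ball x₀ ε → x + t • v i ∈ X := by
  by_cases hi : x₀ ∈ X
  · obtain ⟨ε, hε, h⟩ := Metric.isOpen_iff.1 hX.isOpen x₀ hi
    exact ⟨ε, hε, (EuclideanSpace.basisFun (Fin d) ℝ).toBasis, fun x _ i t _ ht => h ht⟩
  have hb : x₀ ∈ frontier X := by
    rw [hX.isOpen.frontier_eq]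
    exact ⟨hx₀, hi⟩
  obtain ⟨U, hU, r, hr, -, hr', hrU⟩ := hX.smooth_boundary x₀ hb
  set l := fderiv ℝ r x₀ with hl
  have hne : ∃ w, 0 < l w := by
    by_contra! h
    refine hr' (ContinuousLinearMap.ext fun w => le_antisymm (h w) ?_)
    have := h (-w)
    simpa using this
  have hopen : IsOpen {w | 0 < l w} := isOpen_lt continuous_const l.continuous
  -- The half-space of directions in which `r` increases is open and nonempty, so its span has
  -- interior and is everything; a basis can be picked inside it.
  have hspan : ⊤ ≤ Submodule.span ℝ {w | 0 < l w} := by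
    refine (Submodule.eq_top_of_nonempty_interior' _ ?_).ge
    obtain ⟨w, hw⟩ := hne
    exact ⟨w, interior_mono Submodule.subset_span (hopen.interior_eq.symm ▸ hw)⟩
  let b := Module.Basis.ofSpan hspan
  have : Fintype _ := Module.Basis.fintypeIndexOfRankLtAleph0 b (Module.rank_lt_aleph0 ℝ _)
  have hcard := Module.finrank_eq_card_basis b
  rw [finrank_euclideanSpace_fin] at hcard
  let v := b.reindex (Fintype.equivFinOfCardEq hcard.symm)
  have hv : ∀ i, 0 < l (v i) := by
    intro i
    rw [Module.Basis.reindex_apply]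
    exact Module.Basis.ofSpan_subset hspan (Set.mem_range_self _)
  have hcont : Continuous (fderiv ℝ r) := hr.continuous_fderiv (by simp)
  have hnear : ∀ᶠ y in 𝓝 x₀, y ∈ U ∧ ∀ i, 0 < fderiv ℝ r y (v i) := by
    refine (eventually_mem_set.2 hU).and (eventually_all.2 fun i => ?_)
    exact ((hcont.clm_apply continuous_const).continuousAt.eventually_const_lt (hv i))
  obtain ⟨ε, hε, h⟩ := Metric.eventually_nhds_iff_ball.1 hnear
  refine ⟨ε, hε, v, fun x hx i t ht hxt => ?_⟩
  have key : ∀ y ∈ Metric.ball x₀ ε, (y ∈ X ↔ r y < 0) := by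
    intro y hy
    have h1 : y ∈ X ∩ U ↔ y ∈ {x | r x < 0} ∩ U := by rw [hrU]
    simpa [(h y hy).1] using h1
  rw [key _ hxt]
  refine lt_of_le_of_lt ?_ ((key x hx.2).1 hx.1)
  have hder : ∀ s : ℝ, HasDerivAt (fun s : ℝ => r (x + s • v i)) (fderiv ℝ r (x + s • v i) (v i)) s := by
    intro s
    have h1 : HasDerivAt (fun s : ℝ => x + s • v i) (v i) s := by
      simpa using ((hasDerivAt_id s).smul_const (v i)).const_add x
    exact ((hr.differentiable (by simp)).differentiableAt.hasFDerivAt).comp_hasDerivAt s h1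
  -- In the ball `r` increases along each `v i`, so moving backward keeps `r` negative. The
  -- intermediate points lie in the ball by convexity.
  have hmono : MonotoneOn (fun s : ℝ => r (x + s • v i)) (Set.Icc t 0) := by
    refine monotoneOn_of_deriv_nonneg (convex_Icc t 0)
      (fun s _ => (hder s).continuousAt.continuousWithinAt)
      (fun s _ => (hder s).differentiableAt.differentiableWithinAt) fun s hs => ?_
    rw [(hder s).deriv]
    rw [interior_Icc] at hs
    refine ((h _ ?_).2 i).le
    have htn : t < 0 := hs.1.trans hs.2
    have := (convex_ball x₀ ε) hx.2 hxt (a := 1 - s / t) (b := s / t)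
      (by rw [sub_nonneg, div_le_one_of_neg htn]; exact hs.1.le)
      (div_nonneg_of_nonpos hs.2.le htn.le) (by ring)
    convert! this using 1
    rw [smul_add, smul_smul, div_mul_cancel₀ _ htn.ne, ← add_assoc, ← add_smul]
    simp
  simpa using hmono ⟨le_rfl, ht⟩ ⟨ht, le_rfl⟩ ht

open Function in
/-- The Gagliardo–Nirenberg inequality on a set which is stable, within `B`, under backward
translation along the vectors of a basis, for functions supported in `B`. -/
theorem exists_lintegral_pow_le_of_translation {d : ℕ} {p : ℝ}
    (hp : Real.HolderConjugate (d : ℝ) p) (v : Module.Basis (Fin d) ℝ (EuclideanSpace ℝ (Fin d)))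
    {X B : Set (EuclideanSpace ℝ (Fin d))} (hXm : MeasurableSet X)
    (hXB : ∀ x ∈ X ∩ B, ∀ i, ∀ t ≤ (0 : ℝ), x + t • v i ∈ B → x + t • v i ∈ X) :
    ∃ C : ℝ≥0∞, C ≠ ⊤ ∧ ∀ f : EuclideanSpace ℝ (Fin d) → ℂ, ContDiff ℝ 1 f →
      HasCompactSupport f → tsupport f ⊆ B →
      ∫⁻ x in X, ‖f x‖ₑ ^ p ≤ C * (∫⁻ x in X, ‖fderiv ℝ f x‖ₑ) ^ p := by
  let L : (Fin d → ℝ) ≃L[ℝ] EuclideanSpace ℝ (Fin d) := v.equivFunL.symm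
  have hL : ∀ y i t, L (update y i t) = L y + (t - y i) • v i := by
    intro y i t
    have h1 : update y i t = y + (t - y i) • Pi.single i 1 := by
      ext j
      by_cases h : j = i
      · subst h; simp
      · simp [h]
    rw [h1, map_add, map_smul]
    congr 2
    refine (v.equivFun_symm_apply _).trans ?_
    simp [Pi.single_apply, ite_smul]
  have hLm : Measurable L := L.continuous.measurable
  have : (Measure.map L volume).IsAddHaarMeasure :=
    L.isAddHaarMeasure_map volume
  -- Uniqueness of Haar measure stands in for the Jacobian of the coordinate change.
  obtain ⟨c, hc0, hc, hcL⟩ : ∃ c : ℝ≥0∞, c ≠ 0 ∧ c ≠ ⊤ ∧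
      (volume : Measure (EuclideanSpace ℝ (Fin d))) = c • Measure.map L volume :=
    ⟨_, ENNReal.coe_ne_zero.2 (Measure.addHaarScalarFactor_pos_of_isAddHaarMeasure _ _).ne',
      ENNReal.coe_ne_top, Measure.isAddLeftInvariant_eq_smul _ _⟩
  have hint : ∀ h : EuclideanSpace ℝ (Fin d) → ℝ≥0∞, Measurable h →
      ∫⁻ x in X, h x = c * ∫⁻ y, X.indicator h (L y) := by
    intro h hh
    rw [← lintegral_indicator hXm, hcL, lintegral_smul_measure, smul_eq_mul,
      lintegral_map (hh.indicator hXm) hLm]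
  set M : ℝ≥0∞ := ∑ i, ‖v i‖ₑ with hM
  have hMt : M ≠ ⊤ := by simp [hM]
  have hp0 : 0 < p := hp.symm.pos
  refine ⟨c * (M * c⁻¹) ^ p, ?_, fun f hf hfc hfB => ?_⟩
  · exact ENNReal.mul_ne_top hc (ENNReal.rpow_ne_top_of_nonneg hp0.le
      (ENNReal.mul_ne_top hMt (ENNReal.inv_ne_top.2 hc0)))
  have hf' : Continuous (fderiv ℝ f) := hf.continuous_fderiv (by simp)
  set G : (Fin d → ℝ) → ℝ≥0∞ := fun y => M * X.indicator (fun x => ‖fderiv ℝ f x‖ₑ) (L y) with hG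
  have hGm : Measurable G :=
    ((hf'.enorm.measurable.indicator hXm).comp hLm).const_mul M
  have hd2 : 1 < (d : ℝ) := hp.lt
  have hline : ∀ y i, X.indicator (fun x => ‖f x‖ₑ) (L y) ≤ ∫⁻ t, G (update y i t) := by
    intro y i
    by_cases hy : L y ∈ X
    swap
    · simp [hy]
    rw [Set.indicator_of_mem hy]
    by_cases hyB : L y ∈ B
    swap
    · rw [image_eq_zero_of_notMem_tsupport (fun h => hyB (hfB h))]
      simp
    have hd : ∀ t, HasDerivAt (fun t => f (L (update y i t))) (fderiv ℝ f (L (update y i t)) (v i)) t := by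
      intro t
      have h1 : HasDerivAt (fun t : ℝ => L (update y i t)) (v i) t := by
        simp_rw [hL]
        simpa using (((hasDerivAt_id t).sub_const (y i)).smul_const (v i)).const_add (L y)
      exact ((hf.differentiable (by simp)).differentiableAt.hasFDerivAt).comp_hasDerivAt t h1
    have hu : ContDiff ℝ 1 (fun t => f (L (update y i t))) :=
      hf.comp (L.contDiff.comp (contDiff_update 1 y i))
    have hcs : HasCompactSupport (fun t => f (L (update y i t))) :=
      (hfc.comp_homeomorph L.toHomeomorph).comp_isClosedEmbedding (isClosedEmbedding_update y i)
    -- Only the backward half-line is integrated: its points in `B` lie in `X` by stability, and at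
    -- its points outside `B` the derivative vanishes.
    calc ‖f (L y)‖ₑ ≤ ∫⁻ t in Set.Iic (y i), ‖deriv (fun t => f (L (update y i t))) t‖ₑ := by
          refine le_trans (by simp) (HasCompactSupport.enorm_le_lintegral_Ici_deriv hu hcs (y i))
      _ ≤ ∫⁻ t in Set.Iic (y i), G (update y i t) := by
          refine setLIntegral_mono' measurableSet_Iic fun t ht => ?_
          rw [(hd t).deriv]
          by_cases hB : L (update y i t) ∈ B
          · have hX : L (update y i t) ∈ X := by
              rw [hL] at hB ⊢
              exact hXB _ ⟨hy, hyB⟩ i _ (sub_nonpos.2 ht) hB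
            simp only [hG, Set.indicator_of_mem hX]
            refine (ContinuousLinearMap.le_opENorm _ _).trans ?_
            rw [mul_comm]
            gcongr
            exact Finset.single_le_sum (f := fun i => ‖v i‖ₑ) (fun _ _ => zero_le) (Finset.mem_univ i)
          · have : fderiv ℝ f (L (update y i t)) = 0 :=
              image_eq_zero_of_notMem_tsupport fun h => hB (hfB (tsupport_fderiv_subset ℝ h))
            simp [this]
      _ ≤ ∫⁻ t, G (update y i t) := setLIntegral_le_lintegral _ _
  rw [hint _ (hf.continuous.enorm.measurable.pow_const p), hint _ hf'.enorm.measurable]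
  have hind : ∀ y, X.indicator (fun x => ‖f x‖ₑ ^ p) (L y)
      ≤ ∏ i : Fin d, (∫⁻ t, G (update y i t)) ^ ((1 : ℝ) / (Fintype.card (Fin d) - 1 : ℝ)) := by
    intro y
    calc X.indicator (fun x => ‖f x‖ₑ ^ p) (L y)
        = (X.indicator (fun x => ‖f x‖ₑ) (L y)) ^ p := by
          by_cases hy : L y ∈ X <;> simp [hy, hp0]
      -- As `p = d/(d-1)`, the power `p` splits into one factor of exponent `1/(d-1)` per coordinate
      -- direction, the shape required by the grid-lines inequality.
      _ = ∏ _i : Fin d, (X.indicator (fun x => ‖f x‖ₑ) (L y)) ^ ((1 : ℝ) / (d - 1 : ℝ)) := by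
          rw [Finset.prod_const, Finset.card_univ, Fintype.card_fin, ← ENNReal.rpow_natCast,
            ← ENNReal.rpow_mul, hp.conjugate_eq]
          congr 1
          ring
      _ ≤ _ := by
          rw [Fintype.card_fin]
          have : 0 ≤ (1 : ℝ) / (d - 1 : ℝ) := by
            have : 0 < (d : ℝ) - 1 := by linarith
            positivity
          gcongr with i
          exact hline y i
  calc c * ∫⁻ y, X.indicator (fun x => ‖f x‖ₑ ^ p) (L y)
      ≤ c * (∫⁻ y, G y) ^ p := by
        gcongr
        refine (lintegral_mono hind).trans ?_
        exact lintegral_prod_lintegral_pow_le (fun _ => volume) (by simpa using hp) hGm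
    _ = c * (M * c⁻¹) ^ p * (c * ∫⁻ y, X.indicator (fun x => ‖fderiv ℝ f x‖ₑ) (L y)) ^ p := by
        rw [mul_assoc, ← ENNReal.mul_rpow_of_nonneg _ _ hp0.le]
        congr 2
        rw [hG, lintegral_const_mul' _ _ hMt, mul_assoc, ← mul_assoc c⁻¹, ENNReal.inv_mul_cancel hc0 hc,
          one_mul]

variable {d : ℕ} {X : Set (EuclideanSpace ℝ (Fin d))}

/-- The Sobolev inequality `W^{1,1}(X) ⊆ L^{d/(d-1)}(X)` for functions which are `C¹` up to the
boundary. -/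
theorem IsSmoothBoundedDomain.exists_lintegral_pow_le (hX : IsSmoothBoundedDomain X) {p : ℝ}
    (hp : Real.HolderConjugate (d : ℝ) p) :
    ∃ C : ℝ≥0∞, C ≠ ⊤ ∧ ∀ f : EuclideanSpace ℝ (Fin d) → ℂ, ContDiff ℝ 1 f →
      ∫⁻ x in X, ‖f x‖ₑ ^ p ≤ C * (∫⁻ x in X, (‖f x‖ₑ + ‖fderiv ℝ f x‖ₑ)) ^ p := by
  have hp0 : 0 < p := hp.symm.pos
  suffices h : ∃ C : ℝ≥0∞, C ≠ ⊤ ∧ ∀ f : EuclideanSpace ℝ (Fin d) → ℂ, ContDiff ℝ 1 f →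
      ∫⁻ x in X ∩ closure X, ‖f x‖ₑ ^ p ≤ C * (∫⁻ x in X, (‖f x‖ₑ + ‖fderiv ℝ f x‖ₑ)) ^ p by
    rwa [Set.inter_eq_left.2 subset_closure] at h
  refine hX.isBounded.isCompact_closure.induction_on
    (p := fun s => ∃ C : ℝ≥0∞, C ≠ ⊤ ∧ ∀ f : EuclideanSpace ℝ (Fin d) → ℂ, ContDiff ℝ 1 f →
      ∫⁻ x in X ∩ s, ‖f x‖ₑ ^ p ≤ C * (∫⁻ x in X, (‖f x‖ₑ + ‖fderiv ℝ f x‖ₑ)) ^ p) ?_ ?_ ?_ ?_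
  · exact ⟨0, by simp, fun f _ => by simp⟩
  · rintro s t hst ⟨C, hC, h⟩
    exact ⟨C, hC, fun f hf =>
      (lintegral_mono_set (Set.inter_subset_inter_right _ hst)).trans (h f hf)⟩
  · rintro s t ⟨C, hC, h⟩ ⟨C', hC', h'⟩
    refine ⟨C + C', ENNReal.add_ne_top.2 ⟨hC, hC'⟩, fun f hf => ?_⟩
    rw [Set.inter_union_distrib_left, add_mul]
    exact (lintegral_union_le _ _ _).trans (add_le_add (h f hf) (h' f hf))
  · intro x₀ hx₀
    obtain ⟨ε, hε, v, hv⟩ := hX.exists_ball_basis hx₀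
    obtain ⟨C, hC, h⟩ := exists_lintegral_pow_le_of_translation hp v hX.isOpen.measurableSet hv
    -- The cut-off is `1` on the ball of radius `ε/4`, where the estimate is wanted, and supported
    -- well inside the ball of radius `ε`, where translation stability holds.
    let ψ : ContDiffBump x₀ := ⟨ε / 4, ε / 2, by positivity, by linarith⟩
    have hψ : ContDiff ℝ 1 (ψ : EuclideanSpace ℝ (Fin d) → ℝ) := ψ.contDiff
    obtain ⟨K, hK⟩ : ∃ K : ℝ, ∀ x, ‖fderiv ℝ ψ x‖ ≤ K :=
      (hψ.continuous_fderiv (by simp)).bounded_above_of_compact_support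
        (ψ.hasCompactSupport.fderiv (𝕜 := ℝ))
    set K' : ℝ≥0∞ := 1 + ENNReal.ofReal K with hK'
    refine ⟨Metric.ball x₀ (ε / 4),
      mem_nhdsWithin_of_mem_nhds (Metric.ball_mem_nhds _ (by positivity)), C * K' ^ p,
      ENNReal.mul_ne_top hC (ENNReal.rpow_ne_top_of_nonneg hp0.le (by simp [hK'])), fun f hf => ?_⟩
    have hψf : ContDiff ℝ 1 (fun x => ψ x • f x) := hψ.smul hf
    calc ∫⁻ x in X ∩ Metric.ball x₀ (ε / 4), ‖f x‖ₑ ^ p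
        = ∫⁻ x in X ∩ Metric.ball x₀ (ε / 4), ‖ψ x • f x‖ₑ ^ p := by
          refine setLIntegral_congr_fun (hX.isOpen.measurableSet.inter measurableSet_ball)
            fun x hx => ?_
          rw [ψ.one_of_mem_closedBall (Metric.ball_subset_closedBall hx.2), one_smul]
      _ ≤ ∫⁻ x in X, ‖ψ x • f x‖ₑ ^ p := lintegral_mono_set Set.inter_subset_left
      _ ≤ C * (∫⁻ x in X, ‖fderiv ℝ (fun x => ψ x • f x) x‖ₑ) ^ p := by
          refine h _ hψf ψ.hasCompactSupport.smul_right ?_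
          refine (tsupport_smul_subset_left _ _).trans ?_
          rw [ψ.tsupport_eq]
          exact Metric.closedBall_subset_ball (by change ε / 2 < ε; linarith)
      _ ≤ C * (∫⁻ x in X, K' * (‖f x‖ₑ + ‖fderiv ℝ f x‖ₑ)) ^ p := by
          gcongr with x
          have hder : fderiv ℝ (fun x => ψ x • f x) x
              = ψ x • fderiv ℝ f x + (fderiv ℝ ψ x).smulRight (f x) :=
            fderiv_fun_smul (hψ.differentiable (by simp)).differentiableAt
              (hf.differentiable (by simp)).differentiableAt
          rw [hder]
          refine (enorm_add_le (ψ x • fderiv ℝ f x) ((fderiv ℝ ψ x).smulRight (f x))).trans ?_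
          have h1 : ‖ψ x • fderiv ℝ f x‖ₑ ≤ ‖fderiv ℝ f x‖ₑ := by
            rw [enorm_smul]
            refine mul_le_of_le_one_left' ?_
            rw [Real.enorm_eq_ofReal ψ.nonneg]
            exact ENNReal.ofReal_le_one.2 ψ.le_one
          have h2 : ‖(fderiv ℝ ψ x).smulRight (f x)‖ₑ ≤ ENNReal.ofReal K * ‖f x‖ₑ := by
            rw [← ofReal_norm, ← ofReal_norm, ContinuousLinearMap.norm_smulRight_apply,
              ENNReal.ofReal_mul (norm_nonneg _)]
            gcongr
            exact hK x
          calc _ ≤ ‖fderiv ℝ f x‖ₑ + ENNReal.ofReal K * ‖f x‖ₑ := add_le_add h1 h2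
            _ ≤ (‖f x‖ₑ + ‖fderiv ℝ f x‖ₑ) + ENNReal.ofReal K * (‖f x‖ₑ + ‖fderiv ℝ f x‖ₑ) := by
              gcongr
              · exact le_add_self
              · exact le_self_add
            _ = _ := by rw [hK', add_mul, one_mul]
      _ = _ := by
          rw [lintegral_const_mul' _ _ (by simp [hK']), ENNReal.mul_rpow_of_nonneg _ _ hp0.le,
            mul_assoc]

/-! ### The `L⁴` inequality for smooth functions -/

theorem lintegral_mul_le_sqrt_mul_sqrt {α : Type*} [MeasurableSpace α] {μ : Measure α}
    {f g : α → ℝ≥0∞} (hf : AEMeasurable f μ) (hg : AEMeasurable g μ) :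
    ∫⁻ x, f x * g x ∂μ ≤ (∫⁻ x, f x ^ 2 ∂μ) ^ (1 / 2 : ℝ) * (∫⁻ x, g x ^ 2 ∂μ) ^ (1 / 2 : ℝ) := by
  simpa using ENNReal.lintegral_mul_le_Lp_mul_Lq μ Real.HolderConjugate.two_two hf hg

/-- The constant `4` bounds the exponent `n + 1` in the chain rule, so one weight serves both the
square (`d = 2`) and the fourth power (`d = 3`). -/
theorem enorm_pow_add_enorm_fderiv_pow_le {f : EuclideanSpace ℝ (Fin d) → ℂ} (hf : ContDiff ℝ 1 f)
    {n : ℕ} (hn : n ≤ 3) (x : EuclideanSpace ℝ (Fin d)) :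
    ‖f x ^ (n + 1)‖ₑ + ‖fderiv ℝ (fun x => f x ^ (n + 1)) x‖ₑ
      ≤ ‖f x‖ₑ ^ n * (‖f x‖ₑ + 4 * ‖fderiv ℝ f x‖ₑ) := by
  rw [fderiv_fun_pow _ (hf.differentiable (by simp)).differentiableAt, enorm_pow, mul_add, pow_succ]
  gcongr
  have : ‖((n + 1 : ℕ) : ℂ)‖ₑ = ((n + 1 : ℕ) : ℝ≥0∞) := by
    rw [← ofReal_norm, Complex.norm_natCast, ENNReal.ofReal_natCast]
  have h4 : ((n + 1 : ℕ) : ℝ≥0∞) ≤ 4 := by exact_mod_cast (by omega : n + 1 ≤ 4)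
  rw [enorm_smul, nsmul_eq_mul, enorm_mul, add_tsub_cancel_right, enorm_pow, this]
  calc _ ≤ 4 * ‖f x‖ₑ ^ n * ‖fderiv ℝ f x‖ₑ := by gcongr
    _ = _ := by ring

/-- The Sobolev inequality `H¹(X) ⊆ L⁴(X)` in dimensions two and three for functions which are
`C¹` up to the boundary. -/
theorem IsSmoothBoundedDomain.exists_lintegral_pow_four_le (hX : IsSmoothBoundedDomain X)
    (hd : d = 2 ∨ d = 3) :
    ∃ C : ℝ≥0∞, C ≠ ⊤ ∧ ∀ f : EuclideanSpace ℝ (Fin d) → ℂ, ContDiff ℝ 1 f →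
      ∫⁻ x in X, ‖f x‖ₑ ^ 4
        ≤ C * (∫⁻ x in X, (‖f x‖ₑ + 4 * ‖fderiv ℝ f x‖ₑ) ^ 2) ^ 2 := by
  have hmeas : ∀ f : EuclideanSpace ℝ (Fin d) → ℂ, ContDiff ℝ 1 f →
      AEMeasurable (fun x => ‖f x‖ₑ) (vol X) ∧
      AEMeasurable (fun x => ‖f x‖ₑ + 4 * ‖fderiv ℝ f x‖ₑ) (vol X) := fun f hf =>
    have h := hf.continuous.enorm.measurable
    ⟨h.aemeasurable, (h.add
      ((hf.continuous_fderiv (by simp)).enorm.measurable.const_mul 4)).aemeasurable⟩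
  have hle : ∀ f : EuclideanSpace ℝ (Fin d) → ℂ, ∫⁻ x in X, ‖f x‖ₑ ^ 2
      ≤ ∫⁻ x in X, (‖f x‖ₑ + 4 * ‖fderiv ℝ f x‖ₑ) ^ 2 := fun f => by
    gcongr
    exact le_self_add
  rcases hd with rfl | rfl
  · obtain ⟨C, hC, h⟩ := hX.exists_lintegral_pow_le (p := 2) (by
      simpa using Real.HolderConjugate.two_two)
    refine ⟨C, hC, fun f hf => ?_⟩
    set D := ∫⁻ x in X, (‖f x‖ₑ + 4 * ‖fderiv ℝ f x‖ₑ) ^ 2 with hD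
    calc ∫⁻ x in X, ‖f x‖ₑ ^ 4 = ∫⁻ x in X, ‖f x ^ (1 + 1)‖ₑ ^ (2 : ℝ) := by
          congr! 2 with x
          rw [enorm_pow, ENNReal.rpow_ofNat, ← pow_mul]
      _ ≤ C * (∫⁻ x in X, (‖f x ^ (1 + 1)‖ₑ + ‖fderiv ℝ (fun x => f x ^ (1 + 1)) x‖ₑ)) ^ (2 : ℝ) :=
          h _ (hf.pow _)
      _ ≤ C * (∫⁻ x in X, ‖f x‖ₑ * (‖f x‖ₑ + 4 * ‖fderiv ℝ f x‖ₑ)) ^ (2 : ℝ) := by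
          gcongr with x
          simpa using enorm_pow_add_enorm_fderiv_pow_le hf (n := 1) (by norm_num) x
      _ ≤ C * (D ^ (1 / 2 : ℝ) * D ^ (1 / 2 : ℝ)) ^ (2 : ℝ) := by
          gcongr
          refine (lintegral_mul_le_sqrt_mul_sqrt (hmeas f hf).1 (hmeas f hf).2).trans ?_
          gcongr
          exact hle f
      _ = C * D ^ 2 := by
          rw [← ENNReal.rpow_add_of_nonneg _ _ (by norm_num) (by norm_num)]
          norm_num
  · obtain ⟨C, hC, h⟩ := hX.exists_lintegral_pow_le (p := 3 / 2) (by
      rw [Real.holderConjugate_iff]; norm_num)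
    refine ⟨C ^ 2, ENNReal.pow_ne_top hC, fun f hf => ?_⟩
    set D := ∫⁻ x in X, (‖f x‖ₑ + 4 * ‖fderiv ℝ f x‖ₑ) ^ 2 with hD
    -- `A` is the integral of `|f|⁶`. The `W^{1,1}` inequality for `f⁴` and Cauchy–Schwarz bound it
    -- by `A^{3/4}` times a gradient term; its finiteness allows the power of `A` to be cancelled.
    set A := ∫⁻ x in X, (‖f x‖ₑ ^ 3) ^ 2 with hA
    have hAt : A ≠ ⊤ := by
      obtain ⟨K, hK⟩ := hX.isBounded.isCompact_closure.exists_bound_of_continuousOn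
        hf.continuous.continuousOn
      refine ne_top_of_le_ne_top ?_ (setLIntegral_mono' hX.isOpen.measurableSet
        (g := fun _ => (ENNReal.ofReal K ^ 3) ^ 2) fun x hx => ?_)
      · rw [setLIntegral_const]
        exact ENNReal.mul_ne_top (by simp) hX.isBounded.measure_lt_top.ne
      · rw [← ofReal_norm]
        gcongr
        exact hK x (subset_closure hx)
    have h1 : A ≤ C * (A ^ (3 / 4 : ℝ) * D ^ (3 / 4 : ℝ)) := by
      calc A = ∫⁻ x in X, ‖f x ^ (3 + 1)‖ₑ ^ (3 / 2 : ℝ) := by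
            rw [hA]
            congr! 2 with x
            rw [enorm_pow, ← pow_mul, ← ENNReal.rpow_natCast, ← ENNReal.rpow_natCast,
              ← ENNReal.rpow_mul]
            norm_num
        _ ≤ C * (∫⁻ x in X,
              (‖f x ^ (3 + 1)‖ₑ + ‖fderiv ℝ (fun x => f x ^ (3 + 1)) x‖ₑ)) ^ (3 / 2 : ℝ) :=
            h _ (hf.pow _)
        _ ≤ C * (∫⁻ x in X, ‖f x‖ₑ ^ 3 * (‖f x‖ₑ + 4 * ‖fderiv ℝ f x‖ₑ)) ^ (3 / 2 : ℝ) := by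
            gcongr with x
            exact enorm_pow_add_enorm_fderiv_pow_le hf (n := 3) le_rfl x
        _ ≤ C * (A ^ (1 / 2 : ℝ) * D ^ (1 / 2 : ℝ)) ^ (3 / 2 : ℝ) := by
            gcongr
            exact lintegral_mul_le_sqrt_mul_sqrt ((hmeas f hf).1.pow_const 3) (hmeas f hf).2
        _ = _ := by
            rw [ENNReal.mul_rpow_of_nonneg _ _ (by norm_num), ← ENNReal.rpow_mul,
              ← ENNReal.rpow_mul]
            norm_num
    have h2 : A ^ (1 / 4 : ℝ) ≤ C * D ^ (3 / 4 : ℝ) := by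
      rcases eq_or_ne A 0 with hA0 | hA0
      · rw [hA0, ENNReal.zero_rpow_of_pos (by norm_num)]
        exact zero_le
      refine (ENNReal.mul_le_mul_iff_left (c := A ^ (3 / 4 : ℝ)) ?_ ?_).1 ?_
      · simp [hA0, hAt]
      · simp [hA0, hAt]
      · rw [← ENNReal.rpow_add _ _ hA0 hAt]
        norm_num
        calc A ≤ _ := h1
          _ = _ := by ring
    have h3 : A ^ (1 / 2 : ℝ) ≤ C ^ 2 * D ^ (3 / 2 : ℝ) := by
      calc A ^ (1 / 2 : ℝ) = (A ^ (1 / 4 : ℝ)) ^ (2 : ℝ) := by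
            rw [← ENNReal.rpow_mul]; norm_num
        _ ≤ (C * D ^ (3 / 4 : ℝ)) ^ (2 : ℝ) := by gcongr
        _ = _ := by
            rw [ENNReal.mul_rpow_of_nonneg _ _ (by norm_num), ← ENNReal.rpow_mul,
              ENNReal.rpow_ofNat]
            norm_num
    -- Interpolation of `L⁴` between `L²` and `L⁶`.
    calc ∫⁻ x in X, ‖f x‖ₑ ^ 4 = ∫⁻ x in X, ‖f x‖ₑ * ‖f x‖ₑ ^ 3 := by
          congr! 2 with x
          ring
      _ ≤ (∫⁻ x in X, ‖f x‖ₑ ^ 2) ^ (1 / 2 : ℝ) * A ^ (1 / 2 : ℝ) :=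
          lintegral_mul_le_sqrt_mul_sqrt (hmeas f hf).1 ((hmeas f hf).1.pow_const 3)
      _ ≤ D ^ (1 / 2 : ℝ) * (C ^ 2 * D ^ (3 / 2 : ℝ)) := by
          gcongr
          exact hle f
      _ = C ^ 2 * D ^ 2 := by
          rw [mul_left_comm, ← ENNReal.rpow_add_of_nonneg _ _ (by norm_num) (by norm_num)]
          norm_num

/-! ### Completeness of `H¹(X)` and of the graph of the trace -/

/-- For each test function and each coordinate, the weak gradient identity equates two continuous
functionals of `(u, G)`, by Cauchy–Schwarz; closed conditions intersect in a closed set. -/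
theorem isClosed_H1 : IsClosed (H1 X : Set (WithLp 2 (Lp ℂ 2 (vol X) ×
    Lp (EuclideanSpace ℂ (Fin d)) 2 (vol X)))) := by
  have h : (H1 X : Set (WithLp 2 (Lp ℂ 2 (vol X) × Lp (EuclideanSpace ℂ (Fin d)) 2 (vol X)))) =
      ⋂ (φ : EuclideanSpace ℝ (Fin d) → ℂ) (_ : ContDiff ℝ ∞ φ) (_ : HasCompactSupport φ)
        (_ : tsupport φ ⊆ X) (i : Fin d),
        {p | ∫ x in X, p.fst x * grad φ x i = - ∫ x in X, p.snd x i * φ x} := by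
    ext p
    simp only [Set.mem_iInter]
    exact Iff.rfl
  rw [h]
  refine isClosed_iInter fun φ => isClosed_iInter fun hφ => isClosed_iInter fun hc =>
    isClosed_iInter fun _ => isClosed_iInter fun i => ?_
  have h1 : ∀ p : WithLp 2 (Lp ℂ 2 (vol X) × Lp (EuclideanSpace ℂ (Fin d)) 2 (vol X)),
      ∫ x in X, p.fst x * grad φ x i
        = (ContinuousLinearMap.mul ℂ ℂ).lpPairing (vol X) 2 2 p.fst (memLp_grad hφ hc i).toLp := by
    intro p
    rw [ContinuousLinearMap.lpPairing_eq_integral]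
    refine integral_congr_ae ?_
    filter_upwards [(memLp_grad (X := X) hφ hc i).coeFn_toLp] with x hx
    simp [hx]
  have h2 : ∀ p : WithLp 2 (Lp ℂ 2 (vol X) × Lp (EuclideanSpace ℂ (Fin d)) 2 (vol X)),
      ∫ x in X, p.snd x i * φ x
        = ((ContinuousLinearMap.mul ℂ ℂ).comp
            (EuclideanSpace.proj (𝕜 := ℂ) i : EuclideanSpace ℂ (Fin d) →L[ℂ] ℂ)).lpPairing
            (vol X) 2 2 p.snd (memLp_test hφ hc).toLp := by
    intro p
    rw [ContinuousLinearMap.lpPairing_eq_integral]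
    refine integral_congr_ae ?_
    filter_upwards [(memLp_test (X := X) hφ hc).coeFn_toLp] with x hx
    simp [hx]
  simp_rw [h1, h2]
  refine isClosed_eq ?_ ?_
  · exact (((ContinuousLinearMap.mul ℂ ℂ).lpPairing (vol X) 2 2).continuous.comp
      (WithLp.fstL 2 ℂ _ _).continuous).clm_apply continuous_const
  · exact ((ContinuousLinearMap.continuous _).comp
      (WithLp.sndL 2 ℂ _ _).continuous).clm_apply continuous_const |>.neg

instance : CompleteSpace (H1 X) := isClosed_H1.completeSpace_coe

theorem grad_add {φ ψ : EuclideanSpace ℝ (Fin d) → ℂ} (hφ : ContDiff ℝ ∞ φ) (hψ : ContDiff ℝ ∞ ψ)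
    (x : EuclideanSpace ℝ (Fin d)) : grad (φ + ψ) x = grad φ x + grad ψ x := by
  ext i
  simp [grad, fderiv_add (hφ.differentiable (by simp)).differentiableAt
    (hψ.differentiable (by simp)).differentiableAt]

theorem grad_const_smul {φ : EuclideanSpace ℝ (Fin d) → ℂ} (hφ : ContDiff ℝ ∞ φ) (c : ℂ)
    (x : EuclideanSpace ℝ (Fin d)) : grad (c • φ) x = c • grad φ x := by
  ext i
  simp [grad, fderiv_const_smul (hφ.differentiable (by simp)).differentiableAt]

theorem continuous_grad {φ : EuclideanSpace ℝ (Fin d) → ℂ} (hφ : ContDiff ℝ ∞ φ) :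
    Continuous (grad φ) :=
  (PiLp.continuous_toLp 2 _).comp
    (continuous_pi fun _ => (hφ.continuous_fderiv (by simp)).clm_apply continuous_const)

section Approximation

variable {α E : Type*} [MeasurableSpace α] {μ : Measure α} [NormedAddCommGroup E]
  {p : ℝ≥0∞}

theorem eLpNorm_add_sub_add_le (hp : 1 ≤ p) {φ ψ : α → E} (hφ : AEStronglyMeasurable φ μ)
    (hψ : AEStronglyMeasurable ψ μ) (a b : Lp E p μ) :
    eLpNorm (fun x => (φ x + ψ x) - (a + b : Lp E p μ) x) p μ
      ≤ eLpNorm (fun x => φ x - a x) p μ + eLpNorm (fun x => ψ x - b x) p μ := by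
  refine le_trans (eLpNorm_congr_ae ?_).le (eLpNorm_add_le
    (hφ.sub (Lp.aestronglyMeasurable a)) (hψ.sub (Lp.aestronglyMeasurable b)) hp)
  filter_upwards [Lp.coeFn_add a b] with x hx
  simp only [hx, Pi.add_apply]
  abel

theorem eLpNorm_const_smul_sub_const_smul [NormedSpace ℂ E] (c : ℂ) (φ : α → E) (a : Lp E p μ) :
    eLpNorm (fun x => c • φ x - (c • a : Lp E p μ) x) p μ
      = ‖c‖ₑ * eLpNorm (fun x => φ x - a x) p μ := by
  rw [← eLpNorm_const_smul]
  refine eLpNorm_congr_ae ?_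
  filter_upwards [Lp.coeFn_smul c a] with x hx
  rw [hx, Pi.smul_apply, Pi.smul_apply, smul_sub]

theorem eLpNorm_sub_le_add_enorm (hp : 1 ≤ p) {φ : α → E} (hφ : AEStronglyMeasurable φ μ)
    (a b : Lp E p μ) :
    eLpNorm (fun x => φ x - a x) p μ ≤ eLpNorm (fun x => φ x - b x) p μ + ‖b - a‖ₑ := by
  rw [Lp.enorm_def]
  refine le_trans (eLpNorm_congr_ae ?_).le (eLpNorm_add_le
    (hφ.sub (Lp.aestronglyMeasurable b)) (Lp.aestronglyMeasurable (b - a)) hp)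
  filter_upwards [Lp.coeFn_sub b a] with x hx
  simp only [Pi.add_apply, hx, Pi.sub_apply]
  exact (sub_add_sub_cancel _ _ _).symm

end Approximation

/-- The `ε`-form avoids extracting a diagonal sequence in the proof that the graph is closed. -/
theorem isTrace_iff {u : H1 X} {t : Lp ℂ 2 (surf X)} :
    IsTrace u t ↔ ∀ ε : ℝ≥0∞, 0 < ε → ∃ φ : EuclideanSpace ℝ (Fin d) → ℂ, ContDiff ℝ ∞ φ ∧
      eLpNorm (fun x => φ x - toL2 u x) 2 (vol X) ≤ ε ∧
      eLpNorm (fun x => grad φ x - weakGrad u x) 2 (vol X) ≤ ε ∧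
      eLpNorm (fun x => φ x - t x) 2 (surf X) ≤ ε := by
  constructor
  · rintro ⟨φ, hφ, h1, h2, h3⟩ ε hε
    obtain ⟨n, hn1, hn2, hn3⟩ := ((h1.eventually_le_const hε).and
      ((h2.eventually_le_const hε).and (h3.eventually_le_const hε))).exists
    exact ⟨φ n, hφ n, hn1, hn2, hn3⟩
  · intro h
    choose φ hφ h1 h2 h3 using fun n : ℕ => h ((n + 1 : ℕ) : ℝ≥0∞)⁻¹ (by simp)
    have h0 : Tendsto (fun n : ℕ => ((n + 1 : ℕ) : ℝ≥0∞)⁻¹) atTop (𝓝 0) :=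
      ENNReal.tendsto_inv_nat_nhds_zero.comp (tendsto_add_atTop_nat 1)
    exact ⟨φ, hφ, tendsto_of_tendsto_of_tendsto_of_le_of_le tendsto_const_nhds h0
        (fun _ => zero_le) h1,
      tendsto_of_tendsto_of_tendsto_of_le_of_le tendsto_const_nhds h0 (fun _ => zero_le) h2,
      tendsto_of_tendsto_of_tendsto_of_le_of_le tendsto_const_nhds h0 (fun _ => zero_le) h3⟩

/-- The space of the pairs `(u, t)` of an element of `H¹(X)` and its boundary trace. -/
def traceSpace (X : Set (EuclideanSpace ℝ (Fin d))) :
    Submodule ℂ (H1 X × Lp ℂ 2 (surf X)) where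
  carrier := {z | IsTrace z.1 z.2}
  zero_mem' := by
    have hg : grad (0 : EuclideanSpace ℝ (Fin d) → ℂ) = 0 := by
      ext x i
      simp [grad]
    refine ⟨fun _ => 0, fun _ => contDiff_const, ?_, ?_, ?_⟩
    · refine tendsto_const_nhds.congr' (.of_forall fun n => (eLpNorm_eq_zero_of_ae_zero ?_).symm)
      filter_upwards [Lp.coeFn_zero ℂ 2 (vol X)] with x hx
      simpa [toL2] using hx
    · refine tendsto_const_nhds.congr' (.of_forall fun n => (eLpNorm_eq_zero_of_ae_zero ?_).symm)
      filter_upwards [Lp.coeFn_zero (EuclideanSpace ℂ (Fin d)) 2 (vol X)] with x hx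
      simpa [weakGrad, hg] using hx
    · refine tendsto_const_nhds.congr' (.of_forall fun n => (eLpNorm_eq_zero_of_ae_zero ?_).symm)
      filter_upwards [Lp.coeFn_zero ℂ 2 (surf X)] with x hx
      simpa using hx
  add_mem' := by
    rintro a b ⟨φ, hφ, h1, h2, h3⟩ ⟨ψ, hψ, k1, k2, k3⟩
    refine ⟨fun n => φ n + ψ n, fun n => (hφ n).add (hψ n), ?_, ?_, ?_⟩
    · exact tendsto_of_tendsto_of_tendsto_of_le_of_le tendsto_const_nhds
        (add_zero (0 : ℝ≥0∞) ▸ h1.add k1) (fun _ => zero_le) fun n => eLpNorm_add_sub_add_le one_le_two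
          (hφ n).continuous.aestronglyMeasurable (hψ n).continuous.aestronglyMeasurable _ _
    · simp_rw [grad_add (hφ _) (hψ _)]
      exact tendsto_of_tendsto_of_tendsto_of_le_of_le tendsto_const_nhds
        (add_zero (0 : ℝ≥0∞) ▸ h2.add k2) (fun _ => zero_le) fun n => eLpNorm_add_sub_add_le one_le_two
          (continuous_grad (hφ n)).aestronglyMeasurable
          (continuous_grad (hψ n)).aestronglyMeasurable _ _
    · exact tendsto_of_tendsto_of_tendsto_of_le_of_le tendsto_const_nhds
        (add_zero (0 : ℝ≥0∞) ▸ h3.add k3) (fun _ => zero_le) fun n => eLpNorm_add_sub_add_le one_le_two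
          (hφ n).continuous.aestronglyMeasurable (hψ n).continuous.aestronglyMeasurable _ _
  smul_mem' := by
    rintro c a ⟨φ, hφ, h1, h2, h3⟩
    have hc : ‖c‖ₑ ≠ ⊤ := enorm_ne_top
    refine ⟨fun n => c • φ n, fun n => (hφ n).const_smul c, ?_, ?_, ?_⟩
    · have h := ENNReal.Tendsto.const_mul h1 (.inr hc)
      rw [mul_zero] at h
      exact h.congr fun n => (eLpNorm_const_smul_sub_const_smul c (φ n) _).symm
    · simp_rw [grad_const_smul (hφ _)]
      have h := ENNReal.Tendsto.const_mul h2 (.inr hc)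
      rw [mul_zero] at h
      exact h.congr fun n => (eLpNorm_const_smul_sub_const_smul c (grad (φ n)) _).symm
    · have h := ENNReal.Tendsto.const_mul h3 (.inr hc)
      rw [mul_zero] at h
      exact h.congr fun n => (eLpNorm_const_smul_sub_const_smul c (φ n) _).symm

theorem isClosed_traceSpace : IsClosed (traceSpace X : Set (H1 X × Lp ℂ 2 (surf X))) := by
  refine isClosed_of_closure_subset fun z hz => ?_
  change IsTrace z.1 z.2
  rw [isTrace_iff]
  intro ε hε
  have hε2 : 0 < ε / 2 := ENNReal.half_pos hε.ne'
  obtain ⟨w, hw, hzw⟩ := EMetric.mem_closure_iff.1 hz (ε / 2) hε2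
  obtain ⟨φ, hφ, h1, h2, h3⟩ := isTrace_iff.1 (show IsTrace w.1 w.2 from hw) (ε / 2) hε2
  rw [edist_comm, Prod.edist_eq, max_lt_iff, edist_eq_enorm_sub, edist_eq_enorm_sub] at hzw
  have hval : ‖toL2 w.1 - toL2 z.1‖ₑ ≤ ‖w.1 - z.1‖ₑ := WithLp.enorm_fst_le _ (w.1 - z.1).1
  have hgrad : ‖weakGrad w.1 - weakGrad z.1‖ₑ ≤ ‖w.1 - z.1‖ₑ :=
    WithLp.enorm_snd_le _ (w.1 - z.1).1
  rw [← ENNReal.add_halves ε]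
  refine ⟨φ, hφ, ?_, ?_, ?_⟩
  · exact (eLpNorm_sub_le_add_enorm one_le_two hφ.continuous.aestronglyMeasurable _
      (toL2 w.1)).trans (add_le_add h1 (hval.trans hzw.1.le))
  · exact (eLpNorm_sub_le_add_enorm one_le_two (continuous_grad hφ).aestronglyMeasurable _
      (weakGrad w.1)).trans (add_le_add h2 (hgrad.trans hzw.1.le))
  · exact (eLpNorm_sub_le_add_enorm one_le_two hφ.continuous.aestronglyMeasurable _
      w.2).trans (add_le_add h3 hzw.2.le)

/-- A closed subspace of a product of Hilbert spaces is a Hilbert space. -/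
theorem exists_hilbert_of_isClosed {E F : Type} [NormedAddCommGroup E] [InnerProductSpace ℂ E]
    [CompleteSpace E] [NormedAddCommGroup F] [InnerProductSpace ℂ F] [CompleteSpace F]
    (K : Submodule ℂ (E × F)) (hK : IsClosed (K : Set (E × F))) :
    ∃ (H : Type) (_ : NormedAddCommGroup H) (_ : InnerProductSpace ℂ H) (_ : CompleteSpace H)
      (a : H →L[ℂ] E) (b : H →L[ℂ] F), (∀ z, (a z, b z) ∈ K) ∧
      (∀ p ∈ K, ∃ z, p.1 = a z ∧ p.2 = b z) ∧ ∀ z, ‖z‖ ^ 2 = ‖a z‖ ^ 2 + ‖b z‖ ^ 2 := by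
  let e := WithLp.prodContinuousLinearEquiv 2 ℂ E F
  let K' : Submodule ℂ (WithLp 2 (E × F)) := K.comap e.toLinearMap
  have hK' : IsClosed (K' : Set (WithLp 2 (E × F))) := hK.preimage e.continuous
  refine ⟨K', inferInstance, inferInstance, hK'.completeSpace_coe,
    (WithLp.fstL 2 ℂ E F).comp K'.subtypeL, (WithLp.sndL 2 ℂ E F).comp K'.subtypeL,
    fun z => z.2, fun p hp => ⟨⟨WithLp.toLp 2 p, hp⟩, rfl, rfl⟩,
    fun z => WithLp.prod_norm_sq_eq_of_L2 z.1⟩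

variable (X) in
/-- A Hilbert space `H` parametrizing the pairs `(u, t)` of an element of `H¹(X)` and its boundary
trace, with the norm `(‖u‖² + ‖∇u‖² + ‖t‖²)^{1/2}`. -/
structure TraceModel (H : Type) [NormedAddCommGroup H] [InnerProductSpace ℂ H] where
  /-- The `H¹(X)` component. -/
  toH1 : H →L[ℂ] H1 X
  /-- The underlying `L²(X)` function. -/
  val : H →L[ℂ] Lp ℂ 2 (vol X)
  /-- The weak gradient. -/
  gradient : H →L[ℂ] Lp (EuclideanSpace ℂ (Fin d)) 2 (vol X)
  /-- The boundary trace. -/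
  trace : H →L[ℂ] Lp ℂ 2 (surf X)
  toL2_toH1 : ∀ z, toL2 (toH1 z) = val z
  weakGrad_toH1 : ∀ z, weakGrad (toH1 z) = gradient z
  isTrace_toH1 : ∀ z, IsTrace (toH1 z) (trace z)
  exists_eq : ∀ u t, IsTrace u t → ∃ z, u = toH1 z ∧ t = trace z
  norm_sq_eq : ∀ z, ‖z‖ ^ 2 = ‖val z‖ ^ 2 + ‖gradient z‖ ^ 2 + ‖trace z‖ ^ 2

variable (X) in
theorem exists_traceModel : ∃ (H : Type) (_ : NormedAddCommGroup H) (_ : InnerProductSpace ℂ H)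
    (_ : CompleteSpace H), Nonempty (TraceModel X H) := by
  obtain ⟨H, i₁, i₂, i₃, a, b, hab, hex, hnorm⟩ :=
    exists_hilbert_of_isClosed (traceSpace X) isClosed_traceSpace
  refine ⟨H, i₁, i₂, i₃, ⟨{
    toH1 := a
    val := (WithLp.fstL 2 ℂ _ _).comp ((H1 X).subtypeL.comp a)
    gradient := (WithLp.sndL 2 ℂ _ _).comp ((H1 X).subtypeL.comp a)
    trace := b
    toL2_toH1 := fun _ => rfl
    weakGrad_toH1 := fun _ => rfl
    isTrace_toH1 := hab
    exists_eq := fun u t h => hex (u, t) h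
    norm_sq_eq := fun z => (hnorm z).trans
      (congrArg (· + ‖b z‖ ^ 2) (WithLp.prod_norm_sq_eq_of_L2 (a z).1)) }⟩⟩

/-! ### Coercivity and differentiation of the inverse -/

theorem ringInverse_apply_apply {H : Type*} [NormedAddCommGroup H] [NormedSpace ℂ H]
    {A : H →L[ℂ] H} (hA : IsUnit A) (z : H) :
    A (Ring.inverse A z) = z := by
  rw [← mul_apply_eq_comp, Ring.mul_inverse_cancel _ hA, one_apply_eq_self]

theorem eq_ringInverse_apply_iff {H : Type*} [NormedAddCommGroup H] [NormedSpace ℂ H]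
    {A : H →L[ℂ] H} (hA : IsUnit A) {z b : H} :
    A z = b ↔ z = Ring.inverse A b := by
  constructor
  · rintro rfl
    rw [← mul_apply_eq_comp, Ring.inverse_mul_cancel _ hA,
      one_apply_eq_self]
  · rintro rfl
    exact ringInverse_apply_apply hA b

section DampedOperator

variable {H L G T : Type*} [NormedAddCommGroup H] [InnerProductSpace ℂ H] [CompleteSpace H]
  [NormedAddCommGroup L] [InnerProductSpace ℂ L] [CompleteSpace L]
  [NormedAddCommGroup G] [InnerProductSpace ℂ G] [CompleteSpace G]
  [NormedAddCommGroup T] [InnerProductSpace ℂ T] [CompleteSpace T]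

/-- The operator representing the form `-⟪Dw, Dz⟫ + k²⟪Jw, Jz⟫ + ik⟪Jw, MJz⟫ + ik⟪Sw, Sz⟫`. -/
def dampedOp (J : H →L[ℂ] L) (D : H →L[ℂ] G) (S : H →L[ℂ] T) (k : ℝ) (M : L →L[ℂ] L) :
    H →L[ℂ] H :=
  -(D† ∘L D) + ((k : ℂ) ^ 2) • (J† ∘L J) + (Complex.I * k) • (J† ∘L (M ∘L J))
    + (Complex.I * k) • (S† ∘L S)

variable (J : H →L[ℂ] L) (D : H →L[ℂ] G) (S : H →L[ℂ] T) (k : ℝ)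

theorem inner_dampedOp (M : L →L[ℂ] L) (w z : H) :
    ⟪w, dampedOp J D S k M z⟫_ℂ = -⟪D w, D z⟫_ℂ + (k : ℂ) ^ 2 * ⟪J w, J z⟫_ℂ
      + Complex.I * k * ⟪J w, M (J z)⟫_ℂ + Complex.I * k * ⟪S w, S z⟫_ℂ := by
  simp [dampedOp, ContinuousLinearMap.adjoint_inner_right]

theorem dampedOp_sub (M M' : L →L[ℂ] L) :
    dampedOp J D S k M' - dampedOp J D S k M = (Complex.I * k) • (J† ∘L ((M' - M) ∘L J)) := by
  ext z
  simp only [dampedOp, sub_apply, add_apply,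
    smul_apply, ContinuousLinearMap.comp_apply, map_sub, smul_sub]
  abel

/-- Lax–Milgram: the imaginary part of the form controls `J z` and `S z`, and the real part then
yields `D z` at the cost of `k²‖J z‖²`. -/
theorem isUnit_dampedOp {k : ℝ} (hk : 0 < k)
    (hJDS : ∀ z, ‖z‖ ^ 2 ≤ ‖J z‖ ^ 2 + ‖D z‖ ^ 2 + ‖S z‖ ^ 2) {q₀ : ℝ} (hq₀ : 0 < q₀)
    {M : L →L[ℂ] L} (hMim : ∀ u, (⟪u, M u⟫_ℂ).im = 0)
    (hMre : ∀ u, q₀ * ‖u‖ ^ 2 ≤ (⟪u, M u⟫_ℂ).re) : IsUnit (dampedOp J D S k M) := by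
  -- The first summand secures `l k ≥ 1`, for the trace term; the second secures `l k q₀ ≥ 1 + k²`,
  -- which absorbs `k²‖J z‖²` and leaves `‖J z‖²`.
  set l : ℝ := 1 / k + (1 + k ^ 2) / (k * q₀) with hl
  have hl0 : 0 < l := by positivity
  have hl1 : 1 ≤ l * k := by
    rw [hl, add_mul, one_div_mul_cancel hk.ne']
    have : 0 < (1 + k ^ 2) / (k * q₀) * k := by positivity
    linarith
  have hl2 : 1 + k ^ 2 ≤ l * k * q₀ := by
    rw [hl, add_mul, add_mul, one_div_mul_cancel hk.ne', div_mul_eq_mul_div, div_mul_eq_mul_div,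
      mul_assoc, mul_div_cancel_right₀ _ (by positivity : k * q₀ ≠ 0)]
    linarith
  let c : ℝ≥0 := ⟨1 / (1 + l), by positivity⟩
  refine ContinuousLinearMap.isUnit_of_forall_le_norm_inner_map (c := c) _
    (show (0 : ℝ) < 1 / (1 + l) by positivity) fun z => ?_
  rw [norm_inner_symm]
  change ‖z‖ ^ 2 * (1 / (1 + l)) ≤ _
  set a := ⟪z, dampedOp J D S k M z⟫_ℂ with ha
  have hre : a.re = -‖D z‖ ^ 2 + k ^ 2 * ‖J z‖ ^ 2 := by
    rw [ha, inner_dampedOp, inner_self_eq_norm_sq_to_K, inner_self_eq_norm_sq_to_K,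
      inner_self_eq_norm_sq_to_K]
    simp [← Complex.ofReal_pow, hMim]
  have him : a.im = k * (⟪J z, M (J z)⟫_ℂ).re + k * ‖S z‖ ^ 2 := by
    rw [ha, inner_dampedOp, inner_self_eq_norm_sq_to_K, inner_self_eq_norm_sq_to_K,
      inner_self_eq_norm_sq_to_K]
    simp [← Complex.ofReal_pow]
  have h1 : ‖z‖ ^ 2 ≤ -a.re + l * a.im := by
    rw [hre, him]
    have e1 : l * k * (q₀ * ‖J z‖ ^ 2) ≤ l * k * (⟪J z, M (J z)⟫_ℂ).re := by
      gcongr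
      exact hMre _
    have e2 := mul_le_mul_of_nonneg_right hl2 (sq_nonneg ‖J z‖)
    have e3 := mul_le_mul_of_nonneg_right hl1 (sq_nonneg ‖S z‖)
    have e4 := hJDS z
    linarith
  have h2 : -a.re + l * a.im ≤ (1 + l) * ‖a‖ := by
    have e1 := (neg_le_abs a.re).trans (Complex.abs_re_le_norm a)
    have e2 := mul_le_mul_of_nonneg_left ((le_abs_self a.im).trans (Complex.abs_im_le_norm a)) hl0.le
    linarith
  rw [mul_one_div, div_le_iff₀' (by positivity)]
  exact h1.trans h2

/-- The derivative of inversion at a unit `U` is `T ↦ -U⁻¹TU⁻¹`. The Lipschitz bound turns its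
remainder, small relative to `A q' - A q`, into one small relative to `q' - q`. -/
theorem isLittleO_ringInverse_apply {P : Type*} [NormedAddCommGroup P] {A : P → H →L[ℂ] H} {q : P}
    {K : ℝ} (hK : ∀ q', ‖A q' - A q‖ ≤ K * ‖q' - q‖) (hA : IsUnit (A q)) (b : H) :
    (fun q' => Ring.inverse (A q') b - Ring.inverse (A q) b
      + Ring.inverse (A q) ((A q' - A q) (Ring.inverse (A q) b))) =o[𝓝 q] fun q' => q' - q := by
  have hbig : (fun q' => A q' - A q) =O[𝓝 q] fun q' => q' - q :=
    .of_bound K (.of_forall hK)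
  have hcont : Tendsto A (𝓝 q) (𝓝 (A q)) := by
    rw [tendsto_iff_norm_sub_tendsto_zero]
    refine squeeze_zero (fun _ => norm_nonneg _) hK ?_
    have : Tendsto (fun q' => K * ‖q' - q‖) (𝓝 q) (𝓝 (K * ‖q - q‖)) :=
      (Continuous.tendsto (by fun_prop) q)
    simpa using this
  obtain ⟨U, hU⟩ := hA
  have h1 := (hasFDerivAt_ringInverse (𝕜 := ℂ) U).isLittleO
  rw [hU] at h1
  have h2 := (h1.comp_tendsto hcont).trans_isBigO hbig
  refine .trans_le ?_ (fun q' => le_rfl)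
  refine (Asymptotics.IsBigO.of_bound ‖b‖ (.of_forall fun q' => ?_)).trans_isLittleO h2
  have h3 : (↑U⁻¹ : H →L[ℂ] H) = Ring.inverse (A q) := by rw [← hU, Ring.inverse_unit]
  rw [mul_comm]
  refine le_trans (le_of_eq ?_) (ContinuousLinearMap.le_opNorm _ b)
  simp [h3]

end DampedOperator

/-! ### Multiplication operators on `L²` -/

section Multiplication

/-- Multiplication of `L²` functions by essentially bounded real functions. -/
def mulL (X : Set (EuclideanSpace ℝ (Fin d))) (q : Lp ℝ ⊤ (vol X)) :
    Lp ℂ 2 (vol X) →L[ℂ] Lp ℂ 2 (vol X) :=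
  (ContinuousLinearMap.mul ℂ ℂ).holderL (vol X) ⊤ 2 2 (Complex.ofRealCLM.compLp q)

theorem coeFn_mulL (q : Lp ℝ ⊤ (vol X)) (u : Lp ℂ 2 (vol X)) :
    mulL X q u =ᵐ[vol X] fun x => (q x : ℂ) * u x := by
  filter_upwards [(ContinuousLinearMap.mul ℂ ℂ).coeFn_holder (r := 2)
    (Complex.ofRealCLM.compLp q) u, Complex.ofRealCLM.coeFn_compLp q] with x hx hx'
  rw [mulL, ContinuousLinearMap.holderL_apply_apply, hx, hx']
  simp

theorem mulL_sub (q q' : Lp ℝ ⊤ (vol X)) : mulL X (q - q') = mulL X q - mulL X q' := by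
  ext1 u
  rw [sub_apply]
  refine Lp.ext ?_
  filter_upwards [coeFn_mulL (q - q') u, coeFn_mulL q u, coeFn_mulL q' u, Lp.coeFn_sub q q',
    Lp.coeFn_sub (mulL X q u) (mulL X q' u)] with x h1 h2 h3 h4 h5
  rw [h1, h5, Pi.sub_apply, h2, h3, h4, Pi.sub_apply, Complex.ofReal_sub, sub_mul]

theorem norm_mulL_le (q : Lp ℝ ⊤ (vol X)) : ‖mulL X q‖ ≤ ‖q‖ := by
  refine ((ContinuousLinearMap.mul ℂ ℂ).holderL (vol X) ⊤ 2 2).le_of_opNorm_le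
    ((ContinuousLinearMap.norm_holderL_le _).trans
      (ContinuousLinearMap.opNorm_mul_le ℂ ℂ)) _ |>.trans ?_
  rw [one_mul]
  refine (ContinuousLinearMap.norm_compLp_le _ _).trans ?_
  simp

theorem inner_mulL (q : Lp ℝ ⊤ (vol X)) (w u : Lp ℂ 2 (vol X)) :
    ⟪w, mulL X q u⟫_ℂ = ∫ x in X, (q x : ℂ) * u x * conj (w x) := by
  rw [L2.inner_def]
  refine integral_congr_ae ?_
  filter_upwards [coeFn_mulL q u] with x hx
  rw [hx, RCLike.inner_apply]

theorem inner_mulL_self (q : Lp ℝ ⊤ (vol X)) (u : Lp ℂ 2 (vol X)) :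
    ⟪u, mulL X q u⟫_ℂ = ((∫ x in X, q x * ‖u x‖ ^ 2 : ℝ) : ℂ) := by
  rw [inner_mulL, ← integral_complex_ofReal]
  refine integral_congr_ae (.of_forall fun x => ?_)
  simp only
  rw [mul_assoc, Complex.mul_conj, Complex.normSq_eq_norm_sq, Complex.ofReal_mul]

theorem mul_norm_sq_le_inner_mulL {q : Lp ℝ ⊤ (vol X)} {q₀ : ℝ} (hq : ∀ᵐ x ∂(vol X), q₀ ≤ q x)
    (u : Lp ℂ 2 (vol X)) : q₀ * ‖u‖ ^ 2 ≤ (⟪u, mulL X q u⟫_ℂ).re := by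
  have hu : Integrable (fun x => ‖u x‖ ^ 2) (vol X) := (Lp.memLp u).integrable_norm_pow (by simp)
  have h1 : ‖u‖ ^ 2 = ∫ x in X, ‖u x‖ ^ 2 := by
    rw [← Complex.ofReal_inj, ← integral_complex_ofReal, Complex.ofReal_pow]
    refine (inner_self_eq_norm_sq_to_K (𝕜 := ℂ) u).symm.trans ?_
    rw [L2.inner_def]
    refine integral_congr_ae (.of_forall fun x => ?_)
    simp only [inner_self_eq_norm_sq_to_K]
    exact (Complex.ofReal_pow _ _).symm
  rw [inner_mulL_self, Complex.ofReal_re, h1, ← integral_const_mul]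
  refine integral_mono_ae (hu.const_mul _) ?_ ?_
  · refine (L2.integrable_inner (𝕜 := ℂ) u (mulL X q u)).re.congr ?_
    filter_upwards [coeFn_mulL q u] with x hx
    rw [hx, RCLike.inner_apply, mul_assoc, Complex.mul_conj, Complex.normSq_eq_norm_sq,
      ← Complex.ofReal_mul]
    exact Complex.ofReal_re _
  · filter_upwards [hq] with x hx
    gcongr

end Multiplication

variable {H : Type} [NormedAddCommGroup H] [InnerProductSpace ℂ H]

theorem TraceModel.norm_val_le (m : TraceModel X H) (z : H) : ‖m.val z‖ ≤ ‖z‖ :=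
  le_of_sq_le_sq (by rw [m.norm_sq_eq]; nlinarith [sq_nonneg ‖m.gradient z‖, sq_nonneg ‖m.trace z‖])
    (norm_nonneg _)

theorem TraceModel.norm_gradient_le (m : TraceModel X H) (z : H) : ‖m.gradient z‖ ≤ ‖z‖ :=
  le_of_sq_le_sq (by rw [m.norm_sq_eq]; nlinarith [sq_nonneg ‖m.val z‖, sq_nonneg ‖m.trace z‖])
    (norm_nonneg _)

/-! ### The embedding into `L⁴` -/

section LFour

theorem norm_fderiv_le_norm_grad (φ : EuclideanSpace ℝ (Fin d) → ℂ)
    (x : EuclideanSpace ℝ (Fin d)) : ‖fderiv ℝ φ x‖ ≤ d * ‖grad φ x‖ := by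
  refine ContinuousLinearMap.opNorm_le_bound _ (by positivity) fun h => ?_
  have hh : fderiv ℝ φ x h = ∑ i, h i • grad φ x i := by
    conv_lhs => rw [← (EuclideanSpace.basisFun (Fin d) ℝ).sum_repr h]
    simp [grad]
  rw [hh]
  refine (norm_sum_le _ _).trans ?_
  calc ∑ i, ‖h i • grad φ x i‖ ≤ ∑ _i : Fin d, ‖h‖ * ‖grad φ x‖ := by
        gcongr with i
        rw [norm_smul]
        gcongr
        · exact PiLp.norm_apply_le h i
        · exact PiLp.norm_apply_le (grad φ x) i
    _ = d * ‖grad φ x‖ * ‖h‖ := by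
        rw [Finset.sum_const, Finset.card_univ, Fintype.card_fin, nsmul_eq_mul]
        ring

theorem IsSmoothBoundedDomain.exists_eLpNorm_four_le (hX : IsSmoothBoundedDomain X)
    (hd : d = 2 ∨ d = 3) :
    ∃ C : ℝ≥0∞, C ≠ ⊤ ∧ ∀ φ : EuclideanSpace ℝ (Fin d) → ℂ, ContDiff ℝ ∞ φ →
      eLpNorm φ 4 (vol X) ≤ C * (eLpNorm φ 2 (vol X) + eLpNorm (grad φ) 2 (vol X)) := by
  obtain ⟨C, hC, h⟩ := hX.exists_lintegral_pow_four_le hd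
  refine ⟨C ^ (1 / 4 : ℝ) * (1 + 4 * d), ?_, fun φ hφ => ?_⟩
  · exact ENNReal.mul_ne_top (ENNReal.rpow_ne_top_of_nonneg (by norm_num) hC)
      (ENNReal.add_ne_top.2 ⟨ENNReal.one_ne_top,
        ENNReal.mul_ne_top (by simp) (ENNReal.natCast_ne_top d)⟩)
  have h4 : eLpNorm φ 4 (vol X) = (∫⁻ x in X, ‖φ x‖ₑ ^ 4) ^ (1 / 4 : ℝ) := by
    rw [eLpNorm_eq_lintegral_rpow_enorm_toReal (by simp) (by simp)]
    simp
  have h2 : (∫⁻ x in X, (‖φ x‖ₑ + 4 * ‖fderiv ℝ φ x‖ₑ) ^ 2) ^ (1 / 2 : ℝ)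
      ≤ eLpNorm φ 2 (vol X) + 4 * d * eLpNorm (grad φ) 2 (vol X) := by
    have e1 : (∫⁻ x in X, (‖φ x‖ₑ + 4 * ‖fderiv ℝ φ x‖ₑ) ^ 2) ^ (1 / 2 : ℝ)
        ≤ eLpNorm (fun x => ‖φ x‖ + (4 * d : ℝ) * ‖grad φ x‖) 2 (vol X) := by
      rw [eLpNorm_eq_lintegral_rpow_enorm_toReal (by simp) (by simp)]
      simp only [ENNReal.toReal_ofNat, ENNReal.rpow_ofNat]
      gcongr with x
      rw [Real.enorm_eq_ofReal (by positivity), ← ofReal_norm, ← ofReal_norm,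
        ENNReal.ofReal_add (norm_nonneg _) (by positivity), mul_assoc,
        ENNReal.ofReal_mul (by norm_num : (0 : ℝ) ≤ 4), ENNReal.ofReal_ofNat]
      gcongr
      exact norm_fderiv_le_norm_grad φ x
    refine e1.trans ((eLpNorm_add_le hφ.continuous.norm.aestronglyMeasurable
      ((continuous_grad hφ).norm.const_smul (4 * d : ℝ)).aestronglyMeasurable one_le_two).trans ?_)
    gcongr
    · exact (eLpNorm_norm φ).le
    · refine (eLpNorm_const_smul (4 * d : ℝ) (fun x => ‖grad φ x‖) 2 (vol X)).trans_le ?_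
      rw [eLpNorm_norm, Real.enorm_eq_ofReal (by positivity),
        ENNReal.ofReal_mul (by norm_num : (0 : ℝ) ≤ 4), ENNReal.ofReal_ofNat,
        ENNReal.ofReal_natCast]
  calc eLpNorm φ 4 (vol X)
      ≤ (C * (∫⁻ x in X, (‖φ x‖ₑ + 4 * ‖fderiv ℝ φ x‖ₑ) ^ 2) ^ 2) ^ (1 / 4 : ℝ) := by
        rw [h4]
        gcongr
        exact h φ (hφ.of_le (by simp))
    _ = C ^ (1 / 4 : ℝ) * (∫⁻ x in X, (‖φ x‖ₑ + 4 * ‖fderiv ℝ φ x‖ₑ) ^ 2) ^ (1 / 2 : ℝ) := by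
        rw [ENNReal.mul_rpow_of_nonneg _ _ (by norm_num), ← ENNReal.rpow_natCast,
          ← ENNReal.rpow_mul]
        norm_num
    _ ≤ C ^ (1 / 4 : ℝ) * ((1 + 4 * d) * (eLpNorm φ 2 (vol X) + eLpNorm (grad φ) 2 (vol X))) := by
        gcongr
        refine h2.trans ?_
        rw [mul_add]
        gcongr
        · exact le_mul_of_one_le_left' le_self_add
        · exact le_add_self
    _ = _ := by rw [mul_assoc]

/-- The definition of the trace already supplies approximants smooth up to the boundary, so no
density theorem is needed: along an a.e. convergent subsequence, Fatou passes the smooth inequality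
to the limit. -/
theorem IsSmoothBoundedDomain.exists_eLpNorm_val_le (hX : IsSmoothBoundedDomain X)
    (hd : d = 2 ∨ d = 3)
    (m : TraceModel X H) : ∃ C : ℝ≥0, ∀ z, eLpNorm (m.val z) 4 (vol X) ≤ C * ‖z‖ₑ := by
  obtain ⟨C, hC, h⟩ := hX.exists_eLpNorm_four_le hd
  lift C to ℝ≥0 using hC
  refine ⟨C * 2, fun z => ?_⟩
  obtain ⟨φ, hφ, h1, h2, -⟩ := m.isTrace_toH1 z
  rw [m.toL2_toH1] at h1
  rw [m.weakGrad_toH1] at h2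
  obtain ⟨ns, hns, hae⟩ := (tendstoInMeasure_of_tendsto_eLpNorm (by simp)
    (fun n => (hφ n).continuous.aestronglyMeasurable) (Lp.aestronglyMeasurable (m.val z))
    h1).exists_seq_tendsto_ae
  have hval : ∀ n, eLpNorm (φ n) 2 (vol X)
      ≤ eLpNorm (fun x => φ n x - m.val z x) 2 (vol X) + ‖m.val z‖ₑ := fun n => by
    rw [Lp.enorm_def]
    refine le_trans (eLpNorm_congr_ae (.of_forall fun x => ?_)).le (eLpNorm_add_le
      ((hφ n).continuous.aestronglyMeasurable.sub (Lp.aestronglyMeasurable (m.val z)))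
      (Lp.aestronglyMeasurable (m.val z)) one_le_two)
    simp
  have hgrad : ∀ n, eLpNorm (grad (φ n)) 2 (vol X)
      ≤ eLpNorm (fun x => grad (φ n) x - m.gradient z x) 2 (vol X) + ‖m.gradient z‖ₑ := fun n => by
    rw [Lp.enorm_def]
    refine le_trans (eLpNorm_congr_ae (.of_forall fun x => ?_)).le (eLpNorm_add_le
      ((continuous_grad (hφ n)).aestronglyMeasurable.sub (Lp.aestronglyMeasurable (m.gradient z)))
      (Lp.aestronglyMeasurable (m.gradient z)) one_le_two)
    simp
  have hlim := ((((h1.add_const ‖m.val z‖ₑ).add (h2.add_const ‖m.gradient z‖ₑ)).comp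
    hns.tendsto_atTop))
  rw [zero_add, zero_add] at hlim
  have hlim' := ENNReal.Tendsto.const_mul hlim (.inr (ENNReal.coe_ne_top (r := C)))
  calc eLpNorm (m.val z) 4 (vol X)
      ≤ atTop.liminf fun n => eLpNorm (φ (ns n)) 4 (vol X) :=
        Lp.eLpNorm_lim_le_liminf_eLpNorm
          (fun n => (hφ (ns n)).continuous.aestronglyMeasurable) _ hae
    _ ≤ C * (‖m.val z‖ₑ + ‖m.gradient z‖ₑ) := by
        rw [← hlim'.liminf_eq]
        refine liminf_le_liminf (.of_forall fun n => (h _ (hφ (ns n))).trans ?_)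
        simp only [Function.comp]
        gcongr
        · exact hval _
        · exact hgrad _
    _ ≤ C * (‖z‖ₑ + ‖z‖ₑ) := by
        gcongr
        · exact enorm_le_iff_norm_le.2 (m.norm_val_le z)
        · exact enorm_le_iff_norm_le.2 (m.norm_gradient_le z)
    _ = _ := by
        push_cast
        ring

instance fact_one_le_four : Fact ((1 : ℝ≥0∞) ≤ 4) := ⟨by norm_num⟩

instance holderTriple_four_four_two : ENNReal.HolderTriple 4 4 2 := ⟨by
  rw [← two_mul, ← ENNReal.toReal_eq_toReal_iff' (by finiteness) (by finiteness)]
  norm_num⟩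

/-- The embedding of the space of traces into `L⁴(X)`. -/
theorem IsSmoothBoundedDomain.exists_LFour (hX : IsSmoothBoundedDomain X) (hd : d = 2 ∨ d = 3)
    (m : TraceModel X H) : ∃ E : H →L[ℂ] Lp ℂ 4 (vol X), ∀ z, E z =ᵐ[vol X] m.val z := by
  obtain ⟨C, hC⟩ := hX.exists_eLpNorm_val_le hd m
  have hmem : ∀ z : H, MemLp (m.val z) 4 (vol X) := fun z =>
    ⟨Lp.aestronglyMeasurable _, (hC z).trans_lt (by finiteness)⟩
  let E₀ : H →ₗ[ℂ] Lp ℂ 4 (vol X) :=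
    { toFun := fun z => (hmem z).toLp
      map_add' := fun z w => by
        rw [← MemLp.toLp_add]
        refine MemLp.toLp_congr _ _ ?_
        rw [map_add]
        exact Lp.coeFn_add _ _
      map_smul' := fun c z => by
        rw [RingHom.id_apply, ← MemLp.toLp_const_smul]
        refine MemLp.toLp_congr _ _ ?_
        rw [map_smul]
        exact Lp.coeFn_smul _ _ }
  refine ⟨E₀.mkContinuous C fun z => ?_, fun z => (hmem z).coeFn_toLp⟩
  change ‖(hmem z).toLp‖ ≤ _
  rw [Lp.norm_toLp]
  refine (ENNReal.toReal_mono (by finiteness) (hC z)).trans ?_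
  simp

end LFour

/-! ### The weak formulation as an operator equation -/

section WeakFormulation

variable [CompleteSpace H]

/-- The operator on the space of traces representing the boundary value problem. -/
def TraceModel.robinOp (m : TraceModel X H) (k : ℝ) (q : Lp ℝ ⊤ (vol X)) :
    H →L[ℂ] H :=
  dampedOp (m.val) (m.gradient) (m.trace) k (mulL X q)

theorem inner_eq_integral {α : Type*} [MeasurableSpace α] {μ : Measure α} (w u : Lp ℂ 2 μ) :
    ⟪w, u⟫_ℂ = ∫ x, u x * conj (w x) ∂μ := by
  rw [L2.inner_def]
  rfl

theorem inner_eq_integral_sum {α : Type*} [MeasurableSpace α] {μ : Measure α}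
    (w u : Lp (EuclideanSpace ℂ (Fin d)) 2 μ) :
    ⟪w, u⟫_ℂ = ∫ x, ∑ i, u x i * conj (w x i) ∂μ := by
  rw [L2.inner_def]
  rfl

/-- Each integral is an inner product against a component of the test pair, and adjoints move
everything onto that pair. The boundary datum sits on the left in the weak form, hence the minus
sign. -/
theorem TraceModel.isSolution_iff (m : TraceModel X H) {k : ℝ} {q : Lp ℝ ⊤ (vol X)} {f : EuclideanSpace ℝ (Fin d) → ℂ}
    {F : Lp ℂ 2 (vol X)} (hf : f =ᵐ[vol X] F) {g : Lp ℂ 2 (surf X)} {u : H1 X} :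
    IsSolution X k q f g u ↔ ∃ z : H, u = m.toH1 z ∧
      m.robinOp k q z = (m.val†) F - (m.trace†) g := by
  have hform : ∀ z w : H,
      (- (∫ x in X, ∑ i, weakGrad (m.toH1 z) x i * conj (weakGrad (m.toH1 w) x i))
        + (k : ℂ) ^ 2 * (∫ x in X, toL2 (m.toH1 z) x * conj (toL2 (m.toH1 w) x))
        + Complex.I * k * (∫ x in X, (q x : ℂ) * toL2 (m.toH1 z) x * conj (toL2 (m.toH1 w) x))
        + Complex.I * k * (∫ x, m.trace z x * conj (m.trace w x) ∂(surf X))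
        + (∫ x, g x * conj (m.trace w x) ∂(surf X))
      = ∫ x in X, f x * conj (toL2 (m.toH1 w) x)) ↔
      ⟪w, m.robinOp k q z⟫_ℂ = ⟪w, (m.val†) F - (m.trace†) g⟫_ℂ := by
    intro z w
    have e1 : ∫ x in X, ∑ i, weakGrad (m.toH1 z) x i * conj (weakGrad (m.toH1 w) x i)
        = ⟪m.gradient w, m.gradient z⟫_ℂ := by
      rw [m.weakGrad_toH1, m.weakGrad_toH1]
      exact (inner_eq_integral_sum _ _).symm
    have e2 : ∫ x in X, toL2 (m.toH1 z) x * conj (toL2 (m.toH1 w) x)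
        = ⟪m.val w, m.val z⟫_ℂ := by
      rw [m.toL2_toH1, m.toL2_toH1]
      exact (inner_eq_integral _ _).symm
    have e3 : ∫ x in X, (q x : ℂ) * toL2 (m.toH1 z) x * conj (toL2 (m.toH1 w) x)
        = ⟪m.val w, mulL X q (m.val z)⟫_ℂ := by
      rw [m.toL2_toH1, m.toL2_toH1]
      exact (inner_mulL _ _ _).symm
    have e4 : ∫ x in X, f x * conj (toL2 (m.toH1 w) x) = ⟪m.val w, F⟫_ℂ := by
      rw [inner_eq_integral]
      refine integral_congr_ae ?_
      filter_upwards [hf] with x hx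
      rw [hx, m.toL2_toH1]
    have e5 : ⟪w, m.robinOp k q z⟫_ℂ = -⟪m.gradient w, m.gradient z⟫_ℂ
        + (k : ℂ) ^ 2 * ⟪m.val w, m.val z⟫_ℂ + Complex.I * k * ⟪m.val w, mulL X q (m.val z)⟫_ℂ
        + Complex.I * k * ⟪m.trace w, m.trace z⟫_ℂ := inner_dampedOp _ _ _ _ _ _ _
    have e6 : ⟪w, (m.val†) F - (m.trace†) g⟫_ℂ = ⟪m.val w, F⟫_ℂ - ⟪m.trace w, g⟫_ℂ := by
      rw [inner_sub_right, ContinuousLinearMap.adjoint_inner_right,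
        ContinuousLinearMap.adjoint_inner_right]
    rw [e1, e2, e3, e4, e5, e6, ← inner_eq_integral, ← inner_eq_integral, eq_sub_iff_add_eq]
  constructor
  · rintro ⟨t, ht, h⟩
    obtain ⟨z, rfl, rfl⟩ := m.exists_eq _ _ ht
    exact ⟨z, rfl, ext_inner_left ℂ fun w =>
      (hform z w).1 (h (m.toH1 w) (m.trace w) (m.isTrace_toH1 w))⟩
  · rintro ⟨z, rfl, hz⟩
    refine ⟨m.trace z, m.isTrace_toH1 z, fun w s hs => ?_⟩
    obtain ⟨w, rfl, rfl⟩ := m.exists_eq _ _ hs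
    exact (hform z w).2 (by rw [hz])

end WeakFormulation

/-! ### The solution operator and its derivative -/

variable [CompleteSpace H]

theorem mulL_add (q q' : Lp ℝ ⊤ (vol X)) : mulL X (q + q') = mulL X q + mulL X q' := by
  have h := mulL_sub (q + q') q'
  rw [add_sub_cancel_right] at h
  rw [h, sub_add_cancel]

theorem mulL_smul (c : ℝ) (q : Lp ℝ ⊤ (vol X)) : mulL X (c • q) = (c : ℂ) • mulL X q := by
  ext1 u
  rw [smul_apply]
  refine Lp.ext ?_
  filter_upwards [coeFn_mulL (c • q) u, coeFn_mulL q u, Lp.coeFn_smul c q,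
    Lp.coeFn_smul (c : ℂ) (mulL X q u)] with x h1 h2 h3 h4
  rw [h1, h4, Pi.smul_apply, h2, h3, Pi.smul_apply, smul_eq_mul, smul_eq_mul, Complex.ofReal_mul,
    mul_assoc]

variable (m : TraceModel X H) {k : ℝ} {q : Lp ℝ ⊤ (vol X)} {g : Lp ℂ 2 (surf X)}

theorem TraceModel.isUnit_robinOp (hk : 0 < k) {q₀ : ℝ} (hq₀ : 0 < q₀)
    (hq : ∀ᵐ x ∂(vol X), q₀ ≤ q x) : IsUnit (m.robinOp k q) :=
  isUnit_dampedOp _ _ _ hk (fun z => (m.norm_sq_eq z).le) hq₀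
    (fun u => by rw [inner_mulL_self, Complex.ofReal_im]) (mul_norm_sq_le_inner_mulL hq)

theorem TraceModel.isSolution_iff_eq (hA : IsUnit (m.robinOp k q))
    {f : EuclideanSpace ℝ (Fin d) → ℂ} {F : Lp ℂ 2 (vol X)} (hf : f =ᵐ[vol X] F) {u : H1 X} :
    IsSolution X k q f g u ↔
      u = m.toH1 (Ring.inverse (m.robinOp k q) ((m.val†) F - (m.trace†) g)) := by
  rw [m.isSolution_iff hf]
  constructor
  · rintro ⟨z, rfl, hz⟩
    rw [(eq_ringInverse_apply_iff hA).1 hz]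
  · rintro rfl
    exact ⟨_, rfl, ringInverse_apply_apply hA _⟩

theorem zero_ae_eq_coeFn_zero : (0 : EuclideanSpace ℝ (Fin d) → ℂ) =ᵐ[vol X]
    (0 : Lp ℂ 2 (vol X)) := (Lp.coeFn_zero ℂ 2 (vol X)).symm

/-- The solution operator of the boundary value problem in terms of a model of the traces. -/
def TraceModel.sol (k : ℝ) (g : Lp ℂ 2 (surf X)) (q : Lp ℝ ⊤ (vol X)) : H :=
  Ring.inverse (m.robinOp k q) (-(m.trace†) g)

theorem TraceModel.isSolution_zero_iff (hA : IsUnit (m.robinOp k q)) {u : H1 X} :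
    IsSolution X k q 0 g u ↔ u = m.toH1 (m.sol k g q) := by
  rw [m.isSolution_iff_eq hA zero_ae_eq_coeFn_zero, map_zero, zero_sub, TraceModel.sol]

theorem TraceModel.solutionMap_eq (hA : IsUnit (m.robinOp k q)) :
    solutionMap X k g q = m.toH1 (m.sol k g q) := by
  have h : ∃ u : H1 X, IsSolution X k q 0 g u := ⟨_, (m.isSolution_zero_iff hA).2 rfl⟩
  rw [solutionMap, dif_pos h]
  exact (m.isSolution_zero_iff hA).1 h.choose_spec

theorem TraceModel.robinOp_sub (q q' : Lp ℝ ⊤ (vol X)) :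
    m.robinOp k q' - m.robinOp k q
      = (Complex.I * k) • ((m.val†) ∘L (mulL X (q' - q) ∘L m.val)) := by
  rw [TraceModel.robinOp, TraceModel.robinOp, dampedOp_sub, mulL_sub]

theorem norm_comp_mulL_comp_le (J : H →L[ℂ] Lp ℂ 2 (vol X)) (c : ℂ) (q : Lp ℝ ⊤ (vol X)) :
    ‖c • ((J†) ∘L (mulL X q ∘L J))‖ ≤ ‖c‖ * (‖J†‖ * ‖J‖) * ‖q‖ := by
  rw [norm_smul, mul_assoc]
  gcongr
  refine (ContinuousLinearMap.opNorm_comp_le _ _).trans ?_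
  rw [mul_assoc]
  gcongr
  refine (ContinuousLinearMap.opNorm_comp_le _ _).trans ?_
  rw [mul_comm]
  gcongr
  exact norm_mulL_le q

/-- The derivative of the solution operator at `q`. -/
def TraceModel.solDeriv (k : ℝ) (g : Lp ℂ 2 (surf X)) (q : Lp ℝ ⊤ (vol X)) :
    Lp ℝ ⊤ (vol X) →L[ℝ] H :=
  LinearMap.mkContinuous
    { toFun := fun ρ => -Ring.inverse (m.robinOp k q)
        (((Complex.I * k) • ((m.val†) ∘L (mulL X ρ ∘L m.val))) (m.sol k g q))
      map_add' := fun ρ σ => by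
        simp only [mulL_add, ContinuousLinearMap.add_comp, ContinuousLinearMap.comp_add, smul_add,
          add_apply, map_add, neg_add]
      map_smul' := fun c ρ => by
        simp only [mulL_smul, ContinuousLinearMap.smul_comp, ContinuousLinearMap.comp_smul,
          smul_apply, map_smul, RingHom.id_apply]
        rw [smul_comm, ← smul_neg, Complex.coe_smul] }
    (‖Ring.inverse (m.robinOp k q)‖ * (‖Complex.I * k‖ * (‖m.val†‖ * ‖m.val‖) * ‖m.sol k g q‖))
    fun ρ => by
      change ‖-Ring.inverse (m.robinOp k q) _‖ ≤ _
      rw [norm_neg, mul_assoc]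
      refine ContinuousLinearMap.le_opNorm_of_le _ ?_
      rw [mul_right_comm]
      exact ContinuousLinearMap.le_of_opNorm_le _ (norm_comp_mulL_comp_le _ _ _) _

theorem TraceModel.solDeriv_apply (ρ : Lp ℝ ⊤ (vol X)) :
    m.solDeriv k g q ρ = -Ring.inverse (m.robinOp k q)
        (((Complex.I * k) • ((m.val†) ∘L (mulL X ρ ∘L m.val))) (m.sol k g q)) := rfl

theorem TraceModel.hasFDerivAt_sol (hA : IsUnit (m.robinOp k q)) :
    HasFDerivAt (m.sol k g) (m.solDeriv k g q) q := by
  refine .of_isLittleO ?_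
  refine (isLittleO_ringInverse_apply (A := m.robinOp k)
    (K := ‖Complex.I * k‖ * (‖m.val†‖ * ‖m.val‖)) (fun q' => ?_) hA (-(m.trace†) g)).congr_left
      fun q' => ?_
  · rw [m.robinOp_sub]
    exact norm_comp_mulL_comp_le _ _ _
  · rw [m.solDeriv_apply, sub_neg_eq_add, m.robinOp_sub]
    rfl

/-- The linearized problem has the same operator; applying its inverse to `J†F` with `F = -ikρu`
gives the derivative formula. -/
theorem TraceModel.isSolution_linearized_iff (hA : IsUnit (m.robinOp k q))
    (ρ : Lp ℝ ⊤ (vol X)) (v : H1 X) :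
    IsSolution X k q (fun x => - (Complex.I * k * ρ x * toL2 (solutionMap X k g q) x)) 0 v ↔
      v = m.toH1 (m.solDeriv k g q ρ) := by
  have hf : (fun x => - (Complex.I * k * ρ x * toL2 (solutionMap X k g q) x)) =ᵐ[vol X]
      (-((Complex.I * k) • mulL X ρ (m.val (m.sol k g q))) : Lp ℂ 2 (vol X)) := by
    filter_upwards [Lp.coeFn_neg ((Complex.I * k) • mulL X ρ (m.val (m.sol k g q))),
      Lp.coeFn_smul (Complex.I * k) (mulL X ρ (m.val (m.sol k g q))),
      coeFn_mulL ρ (m.val (m.sol k g q))] with x h1 h2 h3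
    rw [h1, Pi.neg_apply, h2, Pi.smul_apply, h3, m.solutionMap_eq hA, m.toL2_toH1, smul_eq_mul,
      mul_assoc]
  rw [m.isSolution_iff_eq hA hf, m.solDeriv_apply, map_zero, sub_zero, map_neg, map_neg, map_smul]
  rfl

/-- A lower bound on the coefficient persists, up to a factor, in a neighbourhood. -/
theorem eventually_ae_le {q₀ q₁ : ℝ} (hq : ∀ᵐ x ∂(vol X), q₀ ≤ q x) (h : q₁ < q₀) :
    ∀ᶠ q' in 𝓝 q, ∀ᵐ x ∂(vol X), q₁ ≤ (q' : Lp ℝ ⊤ (vol X)) x := by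
  filter_upwards [Metric.ball_mem_nhds q (sub_pos.2 h)] with q' hq'
  rw [Metric.mem_ball, dist_eq_norm, Lp.norm_def, eLpNorm_exponent_top] at hq'
  filter_upwards [hq, Lp.coeFn_sub q' q, ae_le_eLpNormEssSup (f := (q' - q : Lp ℝ ⊤ (vol X)))
    (μ := vol X)] with x h1 h2 h3
  have h4 : ‖(q' - q : Lp ℝ ⊤ (vol X)) x‖ ≤ (eLpNormEssSup (q' - q : Lp ℝ ⊤ (vol X)) (vol X)).toReal := by
    rw [← toReal_enorm]
    refine ENNReal.toReal_mono ?_ h3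
    rw [← eLpNorm_exponent_top]
    exact Lp.eLpNorm_ne_top _
  rw [h2, Pi.sub_apply, Real.norm_eq_abs] at h4
  linarith [(abs_le.1 (h4.trans hq'.le)).1]

/-! ### The data map as a Hölder product -/

/-- The bilinear map `(a, b) ↦ Re (a b̄)`. -/
def reMulConj : ℂ →L[ℝ] ℂ →L[ℝ] ℝ :=
  (ContinuousLinearMap.compL ℝ ℂ ℂ ℝ Complex.reCLM).comp
    ((ContinuousLinearMap.mul ℝ ℂ).bilinearComp (.id ℝ ℂ) Complex.conjCLE.toContinuousLinearMap)

theorem reMulConj_apply (a b : ℂ) : reMulConj a b = (a * conj b).re := rfl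

/-- The data `q Re(u ū)` as an element of `L²(X)`, for `u ∈ L⁴(X)`. -/
def energy (q : Lp ℝ ⊤ (vol X)) (u w : Lp ℂ 4 (vol X)) : Lp ℝ 2 (vol X) :=
  (ContinuousLinearMap.mul ℝ ℝ).holderL (vol X) ⊤ 2 2 q (reMulConj.holderL (vol X) 4 4 2 u w)

theorem coeFn_energy (q : Lp ℝ ⊤ (vol X)) (u w : Lp ℂ 4 (vol X)) :
    energy q u w =ᵐ[vol X] fun x => q x * (u x * conj (w x)).re := by
  filter_upwards [(ContinuousLinearMap.mul ℝ ℝ).coeFn_holder (r := 2) q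
    (reMulConj.holder 2 u w), reMulConj.coeFn_holder (r := 2) u w] with x h1 h2
  rw [energy, ContinuousLinearMap.holderL_apply_apply, ContinuousLinearMap.holderL_apply_apply, h1,
    h2, reMulConj_apply, ContinuousLinearMap.mul_apply']

/-- Product rule, twice, for the bounded bilinear maps `L⁴ × L⁴ → L²` and `L^∞ × L² → L²`. -/
theorem exists_hasFDerivAt_energy {P : Type*} [NormedAddCommGroup P] [NormedSpace ℝ P]
    {a : P → Lp ℝ ⊤ (vol X)} {a' : P →L[ℝ] Lp ℝ ⊤ (vol X)} {u : P → Lp ℂ 4 (vol X)}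
    {u' : P →L[ℝ] Lp ℂ 4 (vol X)} {p : P} (ha : HasFDerivAt a a' p) (hu : HasFDerivAt u u' p) :
    ∃ D : P →L[ℝ] Lp ℝ 2 (vol X), HasFDerivAt (fun p => energy (a p) (u p) (u p)) D p ∧
      ∀ ρ, D ρ = energy (a p) (u p) (u' ρ) + energy (a p) (u' ρ) (u p)
        + energy (a' ρ) (u p) (u p) := by
  have h1 := (reMulConj.holderL (vol X) 4 4 2).hasFDerivAt_of_bilinear hu hu
  have h2 := ((ContinuousLinearMap.mul ℝ ℝ).holderL (vol X) ⊤ 2 2).hasFDerivAt_of_bilinear ha h1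
  refine ⟨_, h2, fun ρ => ?_⟩
  simp only [energy, ← map_add]
  rfl

theorem TraceModel.heatEnergy_ae_eq (hA : IsUnit (m.robinOp k q))
    {E : H →L[ℂ] Lp ℂ 4 (vol X)} (hE : ∀ z, E z =ᵐ[vol X] m.val z) :
    heatEnergy X k g q =ᵐ[vol X] energy q (E (m.sol k g q)) (E (m.sol k g q)) := by
  filter_upwards [hE (m.sol k g q), coeFn_energy q (E (m.sol k g q)) (E (m.sol k g q))] with x h1 h2
  rw [h2, h1, heatEnergy, m.solutionMap_eq hA, m.toL2_toH1, Complex.mul_conj,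
    Complex.normSq_eq_norm_sq, Complex.ofReal_re]

theorem TraceModel.dataMap_eq (hA : IsUnit (m.robinOp k q))
    {E : H →L[ℂ] Lp ℂ 4 (vol X)} (hE : ∀ z, E z =ᵐ[vol X] m.val z) :
    dataMap X k g q = energy q (E (m.sol k g q)) (E (m.sol k g q)) := by
  have h := m.heatEnergy_ae_eq (g := g) hA hE
  have hmem : MemLp (heatEnergy X k g q) 2 (vol X) := (memLp_congr_ae h).2 (Lp.memLp _)
  rw [dataMap, dif_pos hmem]
  exact Lp.ext (hmem.coeFn_toLp.trans h)

end RobinHelmholtz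

end

/-! ### The main theorem -/

open RobinHelmholtz
theorem lemma4p1 (d : ℕ) (hd : d = 2 ∨ d = 3) (X : Set (EuclideanSpace ℝ (Fin d)))
    (hX : IsSmoothBoundedDomain X) (k : ℝ) (hk : 0 < k)
    (g : Lp ℂ 2 (surf X)) (qmin qmax : ℝ) (hmin : 0 < qmin) (hmax : qmin < qmax) :
    ∀ q ∈ LInftyPlus X qmin qmax,
      -- `u[q]` is well defined: it is the unique solution of its boundary value problem
      (∀ u : H1 X,
        IsSolution X k q 0 g u ↔ u = solutionMap X k g q) ∧
      -- `q |u[q]|²` belongs to `L²(X)`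
      MemLp (heatEnergy X k g q) 2 (vol X) ∧
      ∃ (Du : Lp ℝ ⊤ (vol X) →L[ℝ] H1 X)
        (DF : Lp ℝ ⊤ (vol X) →L[ℝ] Lp ℝ 2 (vol X)),
        HasFDerivAt (solutionMap X k g) Du q ∧
        -- `Du ρ` is the unique solution `v(ρ)` of the linearized problem
        (∀ (ρ : Lp ℝ ⊤ (vol X)) (v : H1 X),
          IsSolution X k q
            (fun x => - (Complex.I * k * ρ x * toL2 (solutionMap X k g q) x)) 0 v ↔
          v = Du ρ) ∧
        HasFDerivAt (dataMap X k g) DF q ∧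
        ∀ ρ : Lp ℝ ⊤ (vol X),
          (DF ρ : EuclideanSpace ℝ (Fin d) → ℝ) =ᵐ[vol X] fun x =>
            ρ x * ‖toL2 (solutionMap X k g q) x‖ ^ 2
              + 2 * q x * (toL2 (solutionMap X k g q) x * conj (toL2 (Du ρ) x)).re := by
  intro q hq
  obtain ⟨H, _, _, _, ⟨m⟩⟩ := exists_traceModel X
  obtain ⟨E, hE⟩ := hX.exists_LFour hd m
  have hq' : ∀ᵐ x ∂(vol X), qmin < q x ∧ q x < qmax := hq
  -- The a.e. strict bounds leave no uniform margin, so nearby coefficients may leave the admissible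
  -- set; the bound `qmin / 2` persists and suffices for invertibility.
  have hnear : ∀ᶠ q' in 𝓝 q, IsUnit (m.robinOp k q') :=
    (eventually_ae_le (hq'.mono fun x hx => hx.1.le) (half_lt_self hmin)).mono fun q' h =>
      m.isUnit_robinOp hk (half_pos hmin) h
  have hA : IsUnit (m.robinOp k q) := hnear.self_of_nhds
  have hsol : HasFDerivAt (m.sol k g) (m.solDeriv k g q) q := m.hasFDerivAt_sol hA
  obtain ⟨DF, hDF, hDF'⟩ := exists_hasFDerivAt_energy (hasFDerivAt_id q)
    ((E.restrictScalars ℝ).hasFDerivAt.comp q hsol)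
  refine ⟨fun u => ?_, (memLp_congr_ae (m.heatEnergy_ae_eq hA hE)).2 (Lp.memLp _),
    (m.toH1.restrictScalars ℝ).comp (m.solDeriv k g q), DF, ?_,
    m.isSolution_linearized_iff hA, ?_, fun ρ => ?_⟩
  · rw [m.isSolution_zero_iff hA, m.solutionMap_eq hA]
  · refine ((m.toH1.restrictScalars ℝ).hasFDerivAt.comp q hsol).congr_of_eventuallyEq ?_
    exact hnear.mono fun q' h => m.solutionMap_eq h
  · exact hDF.congr_of_eventuallyEq (hnear.mono fun q' h => m.dataMap_eq h hE)
  · rw [hDF']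
    set z := m.sol k g q with hz
    set v := m.solDeriv k g q ρ with hv
    have hu : toL2 (solutionMap X k g q) = m.val z := by rw [m.solutionMap_eq hA, m.toL2_toH1]
    have hDu : toL2 (((m.toH1.restrictScalars ℝ).comp (m.solDeriv k g q)) ρ) = m.val v :=
      m.toL2_toH1 v
    rw [hu, hDu]
    filter_upwards [Lp.coeFn_add (energy q (E z) (E v) + energy q (E v) (E z))
        (energy ρ (E z) (E z)), Lp.coeFn_add (energy q (E z) (E v)) (energy q (E v) (E z)),
      coeFn_energy q (E z) (E v), coeFn_energy q (E v) (E z), coeFn_energy ρ (E z) (E z),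
      hE z, hE v] with x h1 h2 h3 h4 h5 h6 h7
    refine h1.trans ?_
    rw [Pi.add_apply, h2, Pi.add_apply, h3, h4, h5, h6, h7, Complex.mul_conj,
      Complex.normSq_eq_norm_sq, Complex.ofReal_re]
    -- The two cross terms `Re(u v̄)` and `Re(v ū)` coincide, which produces the factor `2`.
    simp only [Complex.mul_re, Complex.conj_re, Complex.conj_im]
    ring
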